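/- For real numbers $l,c>0$ let $G_{l,c}$ be the group of isometries of $\mathbb{R}^3$ generated by the translations by $(l,0,0)$ and $(l/2,\sqrt3\,l/2,0)$, the screw rotation $$(x,y,z)\mapsto\left(\tfrac12x-\tfrac{\sqrt3}{2}y,\ \tfrac{\sqrt3}{2}x+\tfrac12y,\ z+\tfrac c6\right),$$ and the rotation of order two $(x,y,z)\mapsto(x,-y,-z)$. A crystallographic group $G$ is of type $P6_122$ if it is conjugate, by an isometry of $\mathbb{R}^3$ (possibly reversing orientation), to $G_{l,c}$ for some $l,c>0$. **Proposition.** Let $G$ be a crystallographic group of type $P6_122$ and let $P\in\mathbb{R}^3$ be any point. Then the Dirichlet stereohedron of $G$ with base point $P$, that is, the closed Voronoi region $$\{x\in\mathbb{R}^3 : |x-P|\le|x-Q|\ \text{for all } Q\in GP\}$$ of $P$ in the Voronoi diagram of the orbit $GP$, has at most $78$ facets (two-dimensional faces). -/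

import Mathlib

noncomputable section

/-- Euclidean 3-space. -/
abbrev E3 : Type := EuclideanSpace ℝ (Fin 3)

/-- The linear map `p ↦ (cos 60° p₀ - sin 60° p₁, sin 60° p₀ + cos 60° p₁, p₂)` followed by the
vertical translation of length `t`: the screw motion of angle `60°` about the third axis. -/
def screwSix (t : ℝ) : E3 ≃ᵢ E3 :=
  IsometryEquiv.mk'
    (fun p => !₂[p 0 / 2 - √3 / 2 * p 1, √3 / 2 * p 0 + p 1 / 2, p 2 + t])
    (fun p => !₂[p 0 / 2 + √3 / 2 * p 1, -(√3 / 2 * p 0) + p 1 / 2, p 2 - t])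
    (by
      have h3 : √3 * √3 = 3 := Real.mul_self_sqrt (by norm_num)
      intro p
      ext i
      fin_cases i
      · simp
        linear_combination (p 0 / 4) * h3
      · simp
        linear_combination (p 1 / 4) * h3
      · simp)
    (by
      have h3 : √3 * √3 = 3 := Real.mul_self_sqrt (by norm_num)
      refine Isometry.of_dist_eq fun p q => ?_
      rw [EuclideanSpace.dist_eq, EuclideanSpace.dist_eq]
      congr 1
      simp only [Fin.sum_univ_three, Real.dist_eq, sq_abs]
      simp
      linear_combination (((p 0 - q 0) ^ 2 + (p 1 - q 1) ^ 2) / 4) * h3)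

/-- The rotation of order two whose axis is the first coordinate axis. -/
def halfTurn : E3 ≃ᵢ E3 :=
  IsometryEquiv.mk' (fun p => !₂[p 0, -p 1, -p 2]) (fun p => !₂[p 0, -p 1, -p 2])
    (by
      intro p
      ext i
      fin_cases i <;> simp)
    (by
      refine Isometry.of_dist_eq fun p q => ?_
      rw [EuclideanSpace.dist_eq, EuclideanSpace.dist_eq]
      congr 1
      simp only [Fin.sum_univ_three, Real.dist_eq, sq_abs]
      simp
      ring)

/-- The group `P6₁22` in standard position with metric parameters `l` (the minimal length of a
horizontal translation) and `c` (the minimal length of a vertical translation). -/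
def groupP6122 (l c : ℝ) : Subgroup (E3 ≃ᵢ E3) :=
  Subgroup.closure
    {IsometryEquiv.addRight !₂[l, 0, 0],
      IsometryEquiv.addRight !₂[l / 2, √3 / 2 * l, 0],
      screwSix (c / 6),
      halfTurn}

/-- A group of isometries of space is of type `P6₁22` if it is conjugate, by an isometry which may
reverse the orientation, to `groupP6122 l c` for some positive `l` and `c`. -/
def IsOfTypeP6122 (G : Subgroup (E3 ≃ᵢ E3)) : Prop :=
  ∃ l c : ℝ, 0 < l ∧ 0 < c ∧ ∃ φ : E3 ≃ᵢ E3,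
    G = (groupP6122 l c).map (MulAut.conj φ).toMonoidHom

/-- The orbit of a point under a group of isometries. -/
def pointOrbit (G : Subgroup (E3 ≃ᵢ E3)) (P : E3) : Set E3 :=
  {Q | ∃ g ∈ G, g P = Q}

/-- The closed Voronoi region of a point `P` with respect to a set `S` of sites. -/
def voronoiRegion (S : Set E3) (P : E3) : Set E3 :=
  {x | ∀ Q ∈ S, dist x P ≤ dist x Q}

/-- The Dirichlet stereohedron of the group `G` with base point `P`. -/
def dirichletStereohedron (G : Subgroup (E3 ≃ᵢ E3)) (P : E3) : Set E3 :=
  voronoiRegion (pointOrbit G P) P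

/-- The facets of a convex body in 3-space: its two-dimensional (exposed) faces. -/
def facets (K : Set E3) : Set (Set E3) :=
  {F | IsExposed ℝ K F ∧ Module.finrank ℝ (vectorSpan ℝ F) = 2}

end

/-! A facet has a relatively interior point equidistant from `P` and exactly one other orbit point
`Q`, all remaining orbit points being strictly farther; `Q` then determines the facet
(`exists_eq_bisector_of_mem_facets`). So it suffices to count neighbors in the strict sense of
`IsNeighbor`.

In coordinates where the horizontal lattice is ℤ² and `c / 6` is the unit of height, the orbit of
`(u, v, w)` is a union of lattice cosets, the layers: `rotLayer k` at height `w + k` and `reflLayer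
k` at height `-w + k`. The center of an empty sphere through two neighbors lies within height 3 of
both, since otherwise a vertical translate by `±6` would be at least as close. Hence, apart from the
two vertical translates themselves, neighbors differ in height by less than 6.

Inside one layer, two neighbors cannot differ by twice a lattice vector (`IsNeighbor.parity`), which
leaves at most 4; the layer of the point itself gives at most the 6 minimal vectors. The remaining
gain comes from mirrors of the horizontal projection. If two points are far apart in height, the
center is confined to a thin slab; orbit points of intermediate height projecting to mirror images
of the two points then rule out a mirror between them (`IsNeighbor.not_separated`). This leaves 2
neighbors in each reflected layer at relative height between 3 and 6, and 1 in each of the screw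
layers `±5`.

The total is 2 (vertical translates) + (6 + 8·4 + 2·1) (screw layers) + 36 (reflected layers) = 78.
-/

/-- The squared distance in the coordinates `(u, v, w)` adapted to the hexagonal lattice. -/
def hexDist (A B : ℝ) (X Y : ℝ × ℝ × ℝ) : ℝ :=
  A * ((X.1 - Y.1) ^ 2 + (X.1 - Y.1) * (X.2.1 - Y.2.1) + (X.2.1 - Y.2.1) ^ 2)
    + B * (X.2.2 - Y.2.2) ^ 2

/-- `X` and `Y` are Voronoi neighbors in `O`: some point is equidistant from both and strictly
farther from every other point of `O`. -/
def IsNeighbor (A B : ℝ) (O : Set (ℝ × ℝ × ℝ)) (X Y : ℝ × ℝ × ℝ) : Prop :=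
  X ≠ Y ∧ ∃ Z, hexDist A B Z X = hexDist A B Z Y ∧
    ∀ W ∈ O, W ≠ X → W ≠ Y → hexDist A B Z X < hexDist A B Z W

/-- Invariance under the generators of `P6₁22`, in hexagonal coordinates. -/
structure IsHexInvariant (O : Set (ℝ × ℝ × ℝ)) : Prop where
  add_mem : ∀ {u v w : ℝ}, (u, v, w) ∈ O → ∀ m n : ℤ, (u + m, v + n, w) ∈ O
  screw_mem : ∀ {u v w : ℝ}, (u, v, w) ∈ O → (-v, u + v, w + 1) ∈ O
  unscrew_mem : ∀ {u v w : ℝ}, (u, v, w) ∈ O → (u + v, -u, w - 1) ∈ O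
  turn_mem : ∀ {u v w : ℝ}, (u, v, w) ∈ O → (u + v, -v, -w) ∈ O

/-! ### Rotations by multiples of 60° and the layers of an orbit -/

/-- The `k`-th power of the rotation by 60° is `rotA k + rotB k * R`. -/
def rotA (k : ℤ) : ℤ := (![1, 0, -1, -1, 0, 1] : Fin 6 → ℤ) (k : ZMod 6)

/-- The `k`-th power of the rotation by 60° is `rotA k + rotB k * R`. -/
def rotB (k : ℤ) : ℤ := (![0, 1, 1, 0, -1, -1] : Fin 6 → ℤ) (k : ZMod 6)

theorem rotA_add_one (k : ℤ) : rotA (k + 1) = -rotB k := by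
  unfold rotA rotB
  push_cast
  generalize (k : ZMod 6) = x
  revert x
  decide

theorem rotB_add_one (k : ℤ) : rotB (k + 1) = rotA k + rotB k := by
  unfold rotA rotB
  push_cast
  generalize (k : ZMod 6) = x
  revert x
  decide

theorem rotA_sub_one (k : ℤ) : rotA (k - 1) = rotA k + rotB k := by
  have h1 := rotA_add_one (k - 1)
  have h2 := rotB_add_one (k - 1)
  simp only [sub_add_cancel] at h1 h2
  omega

theorem rotB_sub_one (k : ℤ) : rotB (k - 1) = -rotA k := by
  have h1 := rotA_add_one (k - 1)
  simp only [sub_add_cancel] at h1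
  omega

theorem rotA_rotB_cases (k : ℤ) :
    (rotA k = 1 ∧ rotB k = 0) ∨ (rotA k = 0 ∧ rotB k = 1) ∨ (rotA k = -1 ∧ rotB k = 1) ∨
    (rotA k = -1 ∧ rotB k = 0) ∨ (rotA k = 0 ∧ rotB k = -1) ∨ (rotA k = 1 ∧ rotB k = -1) := by
  unfold rotA rotB
  generalize (k : ZMod 6) = x
  revert x
  intro (x : Fin 6)
  fin_cases x <;> simp

theorem rotA_zero : rotA 0 = 1 := rfl
theorem rotB_zero : rotB 0 = 0 := rfl

theorem rotA_add_three (k : ℤ) : rotA (k + 3) = -rotA k := by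
  unfold rotA
  push_cast
  generalize (k : ZMod 6) = x
  revert x
  decide

theorem rotB_add_three (k : ℤ) : rotB (k + 3) = -rotB k := by
  unfold rotB
  push_cast
  generalize (k : ZMod 6) = x
  revert x
  decide

theorem rotA_sub_three (k : ℤ) : rotA (k - 3) = -rotA k := by
  have := rotA_add_three (k - 3)
  simp only [sub_add_cancel] at this
  omega

theorem rotB_sub_three (k : ℤ) : rotB (k - 3) = -rotB k := by
  have := rotB_add_three (k - 3)
  simp only [sub_add_cancel] at this
  omega

/-- The layer of images of `X` under screw motions of height `k`. -/
def rotLayer (X : ℝ × ℝ × ℝ) (k : ℤ) : Set (ℝ × ℝ × ℝ) :=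
  {Y | ∃ m n : ℤ, Y = (rotA k * X.1 - rotB k * X.2.1 + m,
    rotB k * X.1 + (rotA k + rotB k) * X.2.1 + n, X.2.2 + k)}

/-- The layer of images of `X` under half-turns and two-fold screw motions about axes of height
`k / 2`. -/
def reflLayer (X : ℝ × ℝ × ℝ) (k : ℤ) : Set (ℝ × ℝ × ℝ) :=
  {Y | ∃ m n : ℤ, Y = (rotA k * (X.1 + X.2.1) + rotB k * X.2.1 + m,
    rotB k * (X.1 + X.2.1) - (rotA k + rotB k) * X.2.1 + n, -X.2.2 + k)}

/-- The orbit of `X` under `P6₁22`, in hexagonal coordinates. -/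
def hexOrbit (X : ℝ × ℝ × ℝ) : Set (ℝ × ℝ × ℝ) :=
  {Y | ∃ k : ℤ, Y ∈ rotLayer X k ∨ Y ∈ reflLayer X k}

/-! ### Closure of invariant sets under the layers -/

section Invariant

variable {O : Set (ℝ × ℝ × ℝ)}

theorem IsHexInvariant.rot_mem (hO : IsHexInvariant O) {u v w : ℝ} (h : (u, v, w) ∈ O) (k : ℤ) :
    ((rotA k * u - rotB k * v, rotB k * u + (rotA k + rotB k) * v, w + k) : ℝ × ℝ × ℝ) ∈ O := by
  induction k using Int.induction_on with
  | zero => simpa [rotA_zero, rotB_zero] using h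
  | succ i ih =>
    have := hO.screw_mem ih
    rw [rotA_add_one, rotB_add_one]
    convert this using 3
    · push_cast; ring
    · push_cast; ring
    · push_cast; ring
  | pred i ih =>
    have := hO.unscrew_mem ih
    rw [rotA_sub_one, rotB_sub_one]
    convert this using 3
    · push_cast; ring
    · push_cast; ring
    · push_cast; ring

theorem IsHexInvariant.rotLayer_subset (hO : IsHexInvariant O) {X : ℝ × ℝ × ℝ} (h : X ∈ O)
    (k : ℤ) : rotLayer X k ⊆ O := by
  rintro _ ⟨m, n, rfl⟩
  exact hO.add_mem (hO.rot_mem h k) m n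

theorem IsHexInvariant.reflLayer_subset (hO : IsHexInvariant O) {X : ℝ × ℝ × ℝ} (h : X ∈ O)
    (k : ℤ) : reflLayer X k ⊆ O := by
  rintro _ ⟨m, n, rfl⟩
  convert hO.add_mem (hO.rot_mem (hO.turn_mem h) k) m n using 3 <;> ring

theorem IsHexInvariant.vertical_mem (hO : IsHexInvariant O) {u v w : ℝ} (h : (u, v, w) ∈ O) :
    (u, v, w + 6) ∈ O ∧ (u, v, w - 6) ∈ O := by
  constructor
  · convert hO.rot_mem h 6 using 3
    · simp [show rotA 6 = 1 from rfl, show rotB 6 = 0 from rfl]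
    · simp [show rotA 6 = 1 from rfl, show rotB 6 = 0 from rfl]
    · simp
  · convert hO.rot_mem h (-6) using 3
    · simp [show rotA (-6) = 1 from rfl, show rotB (-6) = 0 from rfl]
    · simp [show rotA (-6) = 1 from rfl, show rotB (-6) = 0 from rfl]
    · simp [sub_eq_add_neg]

end Invariant

/-! ### Neighbors: symmetries, parity and height of the center -/

section Neighbor

variable {A B : ℝ} {O : Set (ℝ × ℝ × ℝ)} {X Y : ℝ × ℝ × ℝ}

theorem IsNeighbor.symm (h : IsNeighbor A B O X Y) : IsNeighbor A B O Y X := by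
  obtain ⟨hne, Z, h1, h2⟩ := h
  exact ⟨hne.symm, Z, h1.symm, fun W hW hY hX => h1 ▸ h2 W hW hX hY⟩

theorem IsNeighbor.add (hO : IsHexInvariant O) {u v w u' v' w' : ℝ}
    (h : IsNeighbor A B O (u, v, w) (u', v', w')) (m n : ℤ) :
    IsNeighbor A B O (u + m, v + n, w) (u' + m, v' + n, w') := by
  obtain ⟨hne, ⟨x, y, z⟩, h1, h2⟩ := h
  refine ⟨fun h => hne ?_, (x + m, y + n, z), ?_, ?_⟩
  · simpa using h
  · simpa [hexDist] using h1
  · rintro ⟨a, b, c⟩ hW ha hb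
    have := h2 (a - m, b - n, c) (by simpa [sub_eq_add_neg] using hO.add_mem hW (-m) (-n))
      (by contrapose! ha; simp only [Prod.mk.injEq] at ha ⊢; refine ⟨?_, ?_, ?_⟩ <;> linarith)
      (by contrapose! hb; simp only [Prod.mk.injEq] at hb ⊢; refine ⟨?_, ?_, ?_⟩ <;> linarith)
    simp only [hexDist] at this ⊢
    linear_combination this

theorem IsNeighbor.screw (hO : IsHexInvariant O) {u v w u' v' w' : ℝ}
    (h : IsNeighbor A B O (u, v, w) (u', v', w')) :
    IsNeighbor A B O (-v, u + v, w + 1) (-v', u' + v', w' + 1) := by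
  obtain ⟨hne, ⟨x, y, z⟩, h1, h2⟩ := h
  refine ⟨fun h => hne ?_, (-y, x + y, z + 1), ?_, ?_⟩
  · simp only [Prod.mk.injEq] at h ⊢
    refine ⟨?_, ?_, ?_⟩ <;> linarith
  · simp only [hexDist] at h1 ⊢
    linear_combination h1
  · rintro ⟨a, b, c⟩ hW ha hb
    have := h2 (a + b, -a, c - 1) (hO.unscrew_mem hW)
      (by contrapose! ha; simp only [Prod.mk.injEq] at ha ⊢; refine ⟨?_, ?_, ?_⟩ <;> linarith)
      (by contrapose! hb; simp only [Prod.mk.injEq] at hb ⊢; refine ⟨?_, ?_, ?_⟩ <;> linarith)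
    simp only [hexDist] at this ⊢
    linear_combination this

theorem IsNeighbor.unscrew (hO : IsHexInvariant O) {u v w u' v' w' : ℝ}
    (h : IsNeighbor A B O (u, v, w) (u', v', w')) :
    IsNeighbor A B O (u + v, -u, w - 1) (u' + v', -u', w' - 1) := by
  obtain ⟨hne, ⟨x, y, z⟩, h1, h2⟩ := h
  refine ⟨fun h => hne ?_, (x + y, -x, z - 1), ?_, ?_⟩
  · simp only [Prod.mk.injEq] at h ⊢
    refine ⟨?_, ?_, ?_⟩ <;> linarith
  · simp only [hexDist] at h1 ⊢
    linear_combination h1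
  · rintro ⟨a, b, c⟩ hW ha hb
    have := h2 (-b, a + b, c + 1) (hO.screw_mem hW)
      (by contrapose! ha; simp only [Prod.mk.injEq] at ha ⊢; refine ⟨?_, ?_, ?_⟩ <;> linarith)
      (by contrapose! hb; simp only [Prod.mk.injEq] at hb ⊢; refine ⟨?_, ?_, ?_⟩ <;> linarith)
    simp only [hexDist] at this ⊢
    linear_combination this

/-- Parity: two neighbors of `X` which are not lattice translates of `X` do not differ by twice a
lattice vector. -/
theorem IsNeighbor.parity (hO : IsHexInvariant O) {u v w u' v' w' : ℝ}
    (hX : (u, v, w) ∈ O) (hY : (u', v', w') ∈ O) 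
    (hw : ∀ a b : ℤ, (u', v', w') ≠ (u + a, v + b, w)) {m n : ℤ}
    (h1 : IsNeighbor A B O (u, v, w) (u', v', w'))
    (h2 : IsNeighbor A B O (u, v, w) (u' + 2 * m, v' + 2 * n, w')) : m = 0 ∧ n = 0 := by
  by_contra hmn
  obtain ⟨-, ⟨x, y, z⟩, e1, f1⟩ := h1
  obtain ⟨-, ⟨x', y', z'⟩, e2, f2⟩ := h2
  have key : ∀ s t : ℝ, s = s + m → t = t + n → False := fun s t hs ht =>
    hmn ⟨by exact_mod_cast (by linarith : (m : ℝ) = 0), by exact_mod_cast (by linarith : (n : ℝ) = 0)⟩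
  have hw' : ∀ a b a' b' : ℤ, (u' + a, v' + b, w') ≠ (u + a', v + b', w) := by
    intro a b a' b' h
    simp only [Prod.mk.injEq] at h
    apply hw (a' - a) (b' - b)
    simp only [Prod.mk.injEq]
    push_cast
    exact ⟨by linarith, by linarith, h.2.2⟩
  -- With `L = (m, n)`, the pairs `X, Y` and `X - L, Y + L` have the same midpoint, so the neighbor
  -- pair is the strictly shorter one. The pairs `X, Y + 2L` and `X + L, Y + L` likewise share a
  -- midpoint. Their difference vectors are again `Y - X + 2L` and `Y - X`, so the two inequalities
  -- are opposite.
  have a1 := f1 (u + (-m : ℤ), v + (-n : ℤ), w) (hO.add_mem hX (-m) (-n))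
    (fun h => by
      simp only [Prod.mk.injEq] at h; push_cast at h; exact key u v (by linarith) (by linarith))
    (fun h => hw _ _ h.symm)
  have a2 := f1 (u' + m, v' + n, w') (hO.add_mem hY m n)
    (fun h => hw' m n 0 0 (by simpa using h))
    (fun h => by simp only [Prod.mk.injEq] at h; exact key u' v' (by linarith) (by linarith))
  have a3 := f2 (u + m, v + n, w) (hO.add_mem hX m n)
    (fun h => by simp only [Prod.mk.injEq] at h; exact key u v (by linarith) (by linarith))
    (fun h => hw' (2 * m) (2 * n) m n (by push_cast; exact h.symm))
  have a4 := f2 (u' + m, v' + n, w') (hO.add_mem hY m n)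
    (fun h => hw' m n 0 0 (by simpa using h))
    (fun h => by simp only [Prod.mk.injEq] at h; exact key u' v' (by linarith) (by linarith))
  push_cast at a1
  simp only [hexDist] at e1 e2 a1 a2 a3 a4
  linarith

/-- The center of an empty sphere through two neighbors is within vertical distance `3` of both. -/
theorem IsNeighbor.center_height (hB : 0 < B) (hO : IsHexInvariant O) {u v w u' v' w' x y z : ℝ}
    (hX : (u, v, w) ∈ O) (h6 : (u', v', w') ≠ (u, v, w + 6)) (h6' : (u', v', w') ≠ (u, v, w - 6))
    (h : ∀ W ∈ O, W ≠ (u, v, w) → W ≠ (u', v', w') →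
      hexDist A B (x, y, z) (u, v, w) < hexDist A B (x, y, z) W) : w - 3 < z ∧ z < w + 3 := by
  obtain ⟨m1, m2⟩ := hO.vertical_mem hX
  have a1 := h _ m1 (by simp) h6.symm
  have a2 := h _ m2 (by simp) h6'.symm
  simp only [hexDist] at a1 a2
  constructor
  · have : 0 < B * (12 * (z - (w - 3))) := by linarith
    have := (pos_iff_pos_of_mul_pos this).1 hB
    linarith
  · have : 0 < B * (12 * (w + 3 - z)) := by linarith
    have := (pos_iff_pos_of_mul_pos this).1 hB
    linarith

end Neighbor

/-! ### Mirrors of the horizontal projection do not separate neighbors -/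

section Mirror

variable {A B : ℝ} {O : Set (ℝ × ℝ × ℝ)}

theorem mem_of_eq {a b c a' b' c' : ℝ} (h : (a, b, c) ∈ O) (ha : a' = a) (hb : b' = b)
    (hc : c' = c) : (a', b', c') ∈ O := by
  rwa [ha, hb, hc]

/-- If the vertical mirror with normal `(e, f)` separates two neighbors, and the mirror images
occur at suitable heights between them, we get a contradiction. -/
theorem not_isNeighbor_of_mirror (hA : 0 < A) (hB : 0 < B) (hO : IsHexInvariant O)
    {u v w u' v' h t₁ t₂ e f α β : ℝ}
    (hX : (u, v, w) ∈ O) (hY : (u', v', w + h) ∈ O)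
    (hP : (u + α * e, v + α * f, w + t₁) ∈ O) (hQ : (u' - β * e, v' - β * f, w + t₂) ∈ O)
    (hα : 0 ≤ α) (hβ : 0 ≤ β)
    (hαβ : (α + β) * (e ^ 2 + e * f + f ^ 2) ≤
      2 * (u' - u) * e + (u' - u) * f + (v' - v) * e + 2 * (v' - v) * f)
    (h6 : h < 6) (ht₁ : 0 < t₁) (ht₁' : t₁ ≤ 2 * h - 6) (ht₂ : 6 - h ≤ t₂) (ht₂' : t₂ ≤ h)
    (hne : (u' - β * e, v' - β * f, w + t₂) ≠ (u', v', w + h)) :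
    ¬ IsNeighbor A B O (u, v, w) (u', v', w + h) := by
  rintro ⟨-, ⟨x, y, z⟩, e1, f1⟩
  have k1 := IsNeighbor.center_height hB hO hX
    (fun hh => by simp only [Prod.mk.injEq] at hh; linarith)
    (fun hh => by simp only [Prod.mk.injEq] at hh; linarith) f1
  have k2 := IsNeighbor.center_height (u' := u) (v' := v) (w' := w) hB hO hY
    (fun hh => by simp only [Prod.mk.injEq] at hh; linarith)
    (fun hh => by simp only [Prod.mk.injEq] at hh; linarith)
    (fun W hW h1 h2 => by rw [← e1]; exact f1 W hW h2 h1)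
  have a1 := f1 _ hP
    (fun hh => by simp only [Prod.mk.injEq] at hh; linarith)
    (fun hh => by simp only [Prod.mk.injEq] at hh; linarith)
  have a2 := f1 _ hQ (fun hh => by simp only [Prod.mk.injEq] at hh; linarith) hne
  rw [e1] at a2
  simp only [hexDist] at a1 a2
  -- The center has height between `w + h - 3` and `w + 3`. Hence the mirror image of the first
  -- point is vertically closer to it than that point, and the image of the second is vertically no
  -- farther than the second.
  have b1 : 0 < B * (t₁ * (2 * (z - w) - t₁)) :=
    mul_pos hB (mul_pos ht₁ (by linarith))
  have b2 : 0 ≤ B * ((h - t₂) * (t₂ + h - 2 * (z - w))) :=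
    mul_nonneg hB.le (mul_nonneg (by linarith) (by linarith))
  -- So horizontally each image must be farther than its original: the center projects strictly to
  -- the original's side of the corresponding bisector. By `hαβ` these two half-planes are disjoint.
  have c1 : 0 < A * (α * (α * (e ^ 2 + e * f + f ^ 2) +
      (2 * (u - x) * e + (u - x) * f + (v - y) * e + 2 * (v - y) * f))) := by
    linear_combination a1 + b1
  have c2 : 0 < A * (β * (β * (e ^ 2 + e * f + f ^ 2) -
      (2 * (u' - x) * e + (u' - x) * f + (v' - y) * e + 2 * (v' - y) * f))) := by
    linear_combination a2 + b2
  have d1 := pos_of_mul_pos_right ((pos_iff_pos_of_mul_pos c1).1 hA) hα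
  have d2 := pos_of_mul_pos_right ((pos_iff_pos_of_mul_pos c2).1 hA) hβ
  linarith

/-- A family of parallel mirrors `x = n`, all of whose reflections act at suitable heights, does
not separate two neighbors (unless the second one is its own mirror image). Here `x` and `x'` are the coordinates of the neighbors in the direction
normal to the mirrors. -/
theorem IsNeighbor.not_separated (hA : 0 < A) (hB : 0 < B) (hO : IsHexInvariant O)
    {u v w u' v' h t₁ t₂ e f x x' : ℝ}
    (hX : (u, v, w) ∈ O) (hY : (u', v', w + h) ∈ O)
    (hP : ∀ n : ℤ, (u + (n - x) * e, v + (n - x) * f, w + t₁) ∈ O)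
    (hQ : ∀ n : ℤ, (u' + (n - x') * e, v' + (n - x') * f, w + t₂) ∈ O)
    (hxx : (x' - x) * (e ^ 2 + e * f + f ^ 2) =
      2 * (u' - u) * e + (u' - u) * f + (v' - v) * e + 2 * (v' - v) * f)
    (h6 : h < 6) (ht₁ : 0 < t₁) (ht₁' : t₁ ≤ 2 * h - 6) (ht₂ : 6 - h ≤ t₂) (ht₂' : t₂ ≤ h)
    (hef : e ≠ 0 ∨ f ≠ 0) (hn : IsNeighbor A B O (u, v, w) (u', v', w + h)) (n : ℤ) :
    (n < x ∧ n < x') ∨ (x < n ∧ x' < n) ∨ (t₂ = h ∧ x' = n) := by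
  by_contra hc
  rw [← or_assoc, not_or] at hc
  obtain ⟨hc, hn'⟩ := hc
  -- The image of the second point may be that point itself, and then yields no strict inequality;
  -- this is the third alternative of the conclusion.
  have hne : ((u' + (n - x') * e, v' + (n - x') * f, w + t₂) : ℝ × ℝ × ℝ) ≠ (u', v', w + h) := by
    intro h0
    simp only [Prod.mk.injEq, add_eq_left, mul_eq_zero, add_right_inj] at h0
    refine hn' ⟨h0.2.2, ?_⟩
    rcases hef with he | hf
    · linarith [h0.1.resolve_right he]
    · linarith [h0.2.1.resolve_right hf]
  rw [not_or, not_and_or, not_and_or, not_lt, not_lt, not_lt, not_lt] at hc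
  have : (x ≤ n ∧ n ≤ x') ∨ (x' ≤ n ∧ n ≤ x) := by
    rcases le_total x n with h1 | h1 <;> rcases le_total x' n with h2 | h2
    · rcases hc.2 with h3 | h3
      · exact Or.inr ⟨h2, h3⟩
      · exact Or.inl ⟨h1, h3⟩
    · exact Or.inl ⟨h1, h2⟩
    · exact Or.inr ⟨h2, h1⟩
    · rcases hc.1 with h3 | h3
      · exact Or.inl ⟨h3, h2⟩
      · exact Or.inr ⟨h3, h1⟩
  rcases this with ⟨h1, h2⟩ | ⟨h1, h2⟩
  · refine not_isNeighbor_of_mirror (α := n - x) (β := x' - n) (e := e) (f := f) hA hB hO hX hY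
      (hP n) ?_ (by linarith) (by linarith) ?_ h6 ht₁ ht₁' ht₂ ht₂' ?_ hn
    · convert hQ n using 3 <;> ring
    · linear_combination hxx
    · convert hne using 4 <;> ring
  · refine not_isNeighbor_of_mirror (α := x - n) (β := n - x') (e := -e) (f := -f) hA hB hO hX hY
      ?_ ?_ (by linarith) (by linarith) ?_ h6 ht₁ ht₁' ht₂ ht₂' ?_ hn
    · convert hP n using 3 <;> ring
    · convert hQ n using 3 <;> ring
    · linear_combination -hxx
    · convert hne using 4 <;> ring

theorem int_eq_zero_of_not_separated {x : ℝ} {d : ℤ}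
    (h : ∀ n : ℤ, ((n : ℝ) < x ∧ (n : ℝ) < x + d) ∨ (x < n ∧ x + d < n)) : d = 0 := by
  by_contra hd
  rcases lt_or_gt_of_ne hd with h1 | h1
  · have h2 : (d : ℝ) ≤ -1 := by exact_mod_cast (by omega : d ≤ -1)
    have h3 := Int.floor_le x
    have h4 := Int.lt_floor_add_one x
    rcases h ⌊x⌋ with h5 | h5 <;> linarith [h5.1, h5.2]
  · have h2 : (1 : ℝ) ≤ d := by exact_mod_cast h1
    have h3 := Int.floor_le x
    have h4 := Int.lt_floor_add_one x
    rcases h (⌊x⌋ + 1) with h5 | h5 <;> push_cast at h5 <;> linarith [h5.1, h5.2]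

/-- A neighbor in a reflected layer of relative height between `3` and `6` is a pure mirror image
(in horizontal projection), not a glide image. -/
theorem IsNeighbor.pure_reflection (hA : 0 < A) (hB : 0 < B) (hO : IsHexInvariant O)
    {u v w : ℝ} (hX : (u, v, w) ∈ O) {j m n : ℤ} (h3 : 3 < j - 2 * w) (h6 : j - 2 * w < 6)
    (hn : IsNeighbor A B O (u, v, w) (rotA j * (u + v) + rotB j * v + m,
      rotB j * (u + v) - (rotA j + rotB j) * v + n, -w + j)) :
    rotA j * (m + n) + rotB j * n = -m ∧ rotB j * (m + n) - (rotA j + rotB j) * n = -n := by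
  have hY : ((rotA j * (u + v) + rotB j * v + m,
      rotB j * (u + v) - (rotA j + rotB j) * v + n, -w + j) : ℝ × ℝ × ℝ) ∈ O :=
    hO.reflLayer_subset hX j ⟨m, n, rfl⟩
  -- The half-turns of layer `j - 3` project to reflections in mirrors perpendicular to those of
  -- layer `j`. They act on the first point here; on the second they act, up to the lattice, as the
  -- screw motion by 180° of the first, giving `hQ`.
  have hP : ∀ m' n' : ℤ, ((-(rotA j * (u + v) + rotB j * v) + m',
      -(rotB j * (u + v) - (rotA j + rotB j) * v) + n', w + (j - 2 * w - 3)) : ℝ × ℝ × ℝ) ∈ O := by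
    intro m' n'
    refine hO.reflLayer_subset hX (j - 3) ⟨m', n', ?_⟩
    simp only [rotA_sub_three, rotB_sub_three, Prod.mk.injEq]
    refine ⟨?_, ?_, ?_⟩ <;> push_cast <;> ring
  have hQ : ∀ m' n' : ℤ, ((-u + m', -v + n', w + 3) : ℝ × ℝ × ℝ) ∈ O := by
    intro m' n'
    refine hO.rotLayer_subset hX 3 ⟨m', n', ?_⟩
    simp only [show rotA 3 = -1 from rfl, show rotB 3 = 0 from rfl, Prod.mk.injEq]
    refine ⟨?_, ?_, ?_⟩ <;> push_cast <;> ring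
  rw [show -w + (j : ℝ) = w + (j - 2 * w) by ring] at hn hY
  -- Measured normally to the perpendicular mirrors, the two points differ by an integer `d`, the
  -- glide component. A nonzero `d` would leave some mirror `x = n` between them.
  have main : ∀ {e f x : ℝ} {d : ℤ}, (e ≠ 0 ∨ f ≠ 0) → _ → _ → _ → d = 0 :=
    fun {e f x d} k0 k1 k2 k3 => int_eq_zero_of_not_separated (x := x) (d := d) fun n =>
      (IsNeighbor.not_separated (e := e) (f := f) (t₁ := j - 2 * w - 3) (t₂ := 3) hA hB hO hX hY
        k1 k2 k3 h6 (by linarith) (by linarith) (by linarith) (by linarith) k0 hn n).imp_right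
        fun h => h.resolve_right fun h => by linarith [h.1]
  rcases rotA_rotB_cases j with ⟨ha, hb⟩ | ⟨ha, hb⟩ | ⟨ha, hb⟩ | ⟨ha, hb⟩ | ⟨ha, hb⟩ | ⟨ha, hb⟩ <;>
    rw [ha, hb] at main hP ⊢
  · have := main (e := 1) (f := 0) (x := 2 * u + v) (d := 2 * m + n)
      (by norm_num)
      (fun k => mem_of_eq (hP k 0)
        (by push_cast; ring) (by push_cast; ring) rfl)
      (fun k => mem_of_eq (hQ (k - m - n) n)
        (by push_cast; ring) (by push_cast; ring) rfl)
      (by push_cast; ring)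
    omega
  · have := main (e := 1) (f := 1) (x := u + v) (d := m + n)
      (by norm_num)
      (fun k => mem_of_eq (hP k k)
        (by push_cast; ring) (by push_cast; ring) rfl)
      (fun k => mem_of_eq (hQ (k - n) (k - m))
        (by push_cast; ring) (by push_cast; ring) rfl)
      (by push_cast; ring)
    omega
  · have := main (e := 0) (f := 1) (x := u + 2 * v) (d := m + 2 * n)
      (by norm_num)
      (fun k => mem_of_eq (hP 0 k)
        (by push_cast; ring) (by push_cast; ring) rfl)
      (fun k => mem_of_eq (hQ m (k - m - n))
        (by push_cast; ring) (by push_cast; ring) rfl)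
      (by push_cast; ring)
    omega
  · have := main (e := -1) (f := 2) (x := v) (d := n)
      (by norm_num)
      (fun k => mem_of_eq (hP (-k) (2 * k))
        (by push_cast; ring) (by push_cast; ring) rfl)
      (fun k => mem_of_eq (hQ (m + n - k) (2 * k - n))
        (by push_cast; ring) (by push_cast; ring) rfl)
      (by push_cast; ring)
    omega
  · have := main (e := -1) (f := 1) (x := v - u) (d := n - m)
      (by norm_num)
      (fun k => mem_of_eq (hP (-k) k)
        (by push_cast; ring) (by push_cast; ring) rfl)
      (fun k => mem_of_eq (hQ (n - k) (m + k))
        (by push_cast; ring) (by push_cast; ring) rfl)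
      (by push_cast; ring)
    omega
  · have := main (e := 2) (f := -1) (x := u) (d := m)
      (by norm_num)
      (fun k => mem_of_eq (hP (2 * k) (-k))
        (by push_cast; ring) (by push_cast; ring) rfl)
      (fun k => mem_of_eq (hQ (2 * k - m) (m + n - k))
        (by push_cast; ring) (by push_cast; ring) rfl)
      (by push_cast; ring)
    omega

end Mirror

/-! ### Uniqueness of the neighbor in the screw layers `±5` -/

section Five

variable {A B : ℝ} {O : Set (ℝ × ℝ × ℝ)}

/-- For `N = ⌊a + b⌋` the hypothesis gives `2 * N < a + b < N + 1`, so `N ≤ 0`. -/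
theorem lt_one_of_forall_int_le {a b : ℝ}
    (h : ∀ n : ℤ, (n : ℝ) ≤ a + b → (n : ℝ) ≤ a ∧ (n : ℝ) < b) : a + b < 1 := by
  have h1 := h _ (Int.floor_le (a + b))
  have h2 := Int.lt_floor_add_one (a + b)
  have h3 : ((⌊a + b⌋ : ℤ) : ℝ) < (1 : ℤ) := by push_cast; linarith
  have h4 : ((⌊a + b⌋ : ℤ) : ℝ) ≤ (0 : ℤ) := by exact_mod_cast Int.lt_add_one_iff.1 (Int.cast_lt.1 h3)
  push_cast at h4
  linarith

/-- In projection the second point is the first turned by -60° about the origin. Four families of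
mirrors act at admissible heights, and not being separated by them confines the first point to two
small parallelograms. Both lie in the open square of side 1 about the origin, which is what
uniqueness needs. -/
theorem IsNeighbor.fifth_layer_cell (hA : 0 < A) (hB : 0 < B) (hO : IsHexInvariant O)
    {x y w : ℝ} (hX : (x, y, w) ∈ O) (hw₀ : 0 ≤ w) (hw₁ : w < 1)
    (hn : IsNeighbor A B O (x, y, w) (x + y, -x, w + 5)) :
    (0 < x ∧ x < 1 / 2 ∧ 0 ≤ y ∧ y < 1 / 2) ∨ (-(1 / 2) < x ∧ x < 0 ∧ -(1 / 2) < y ∧ y ≤ 0) := by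
  have hY : (x + y, -x, w + 5) ∈ O := by
    refine mem_of_eq (hO.rot_mem hX 5) ?_ ?_ ?_ <;>
      simp [show rotA 5 = 1 from rfl, show rotB 5 = -1 from rfl]
  have hP : ∀ j m n : ℤ, ((rotA j * (x + y) + rotB j * y + m,
      rotB j * (x + y) - (rotA j + rotB j) * y + n, w + (j - 2 * w)) : ℝ × ℝ × ℝ) ∈ O :=
    fun j m n => mem_of_eq (hO.reflLayer_subset hX j ⟨m, n, rfl⟩) rfl rfl (by simp only; ring)
  have hQ : ∀ j m n : ℤ, ((rotA j * (x + y - x) + rotB j * (-x) + m,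
      rotB j * (x + y - x) - (rotA j + rotB j) * (-x) + n, w + (j - 2 * w + 1)) : ℝ × ℝ × ℝ) ∈ O := by
    intro j m n
    refine mem_of_eq (hO.reflLayer_subset hY (j + 3 + 3) ⟨m, n, rfl⟩) ?_ ?_ ?_
    · simp only [rotA_add_three, rotB_add_three]; push_cast; ring
    · simp only [rotA_add_three, rotB_add_three]; push_cast; ring
    · simp only; push_cast; ring
  -- Family `j` is usable when `0 < j - 2 * w ≤ 4`: always for `j = 2, 3, 4`, for `j = 1` when `w <
  -- 1 / 2`, and for `j = 5` when `1 / 2 ≤ w`. The exceptional alternative of `not_separated` needs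
  -- `j - 2 * w = 4`, so it occurs only for `j = 4, w = 0` or `j = 5, w = 1 / 2`.
  have main : ∀ (j : ℤ) {e f s t : ℝ}, (e ≠ 0 ∨ f ≠ 0) → (0 : ℝ) < j - 2 * w →
      (j : ℝ) - 2 * w ≤ 4 → _ → _ → _ → ∀ n : ℤ, _ := fun j e f s t h0 h1 h2 k1 k2 k3 =>
    IsNeighbor.not_separated (x := s) (x' := t) (e := e) (f := f) (t₁ := j - 2 * w)
      (t₂ := j - 2 * w + 1) hA hB hO hX hY k1 k2 k3
      (by norm_num) h1 (by linarith) (by linarith) (by linarith) h0 hn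
  have m60 := main 2 (e := 2) (f := -1) (s := x) (t := x + y) (by norm_num)
    (by push_cast; linarith) (by push_cast; linarith)
    (fun n => mem_of_eq (hP 2 (2 * n) (-n))
      (by simp [show rotA 2 = -1 from rfl, show rotB 2 = 1 from rfl]; ring)
      (by simp [show rotA 2 = -1 from rfl, show rotB 2 = 1 from rfl]; ring) rfl)
    (fun n => mem_of_eq (hQ 2 (2 * n) (-n))
      (by simp [show rotA 2 = -1 from rfl, show rotB 2 = 1 from rfl]; ring)
      (by simp [show rotA 2 = -1 from rfl, show rotB 2 = 1 from rfl]; ring) rfl)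
    (by ring)
  have m90 := main 3 (e := 1) (f := 0) (s := 2 * x + y) (t := x + 2 * y) (by norm_num)
    (by push_cast; linarith) (by push_cast; linarith)
    (fun n => mem_of_eq (hP 3 n 0)
      (by simp [show rotA 3 = -1 from rfl, show rotB 3 = 0 from rfl]; ring)
      (by simp [show rotA 3 = -1 from rfl, show rotB 3 = 0 from rfl]) rfl)
    (fun n => mem_of_eq (hQ 3 n 0)
      (by simp [show rotA 3 = -1 from rfl, show rotB 3 = 0 from rfl]; ring)
      (by simp [show rotA 3 = -1 from rfl, show rotB 3 = 0 from rfl]) rfl)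
    (by ring)
  have m120 := main 4 (e := 1) (f := 1) (s := x + y) (t := y) (by norm_num)
    (by push_cast; linarith) (by push_cast; linarith)
    (fun n => mem_of_eq (hP 4 n n)
      (by simp [show rotA 4 = 0 from rfl, show rotB 4 = -1 from rfl]; ring)
      (by simp [show rotA 4 = 0 from rfl, show rotB 4 = -1 from rfl]; ring) rfl)
    (fun n => mem_of_eq (hQ 4 n n)
      (by simp [show rotA 4 = 0 from rfl, show rotB 4 = -1 from rfl])
      (by simp [show rotA 4 = 0 from rfl, show rotB 4 = -1 from rfl]; ring) rfl)
    (by ring)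
  have m60' : (0 < x ∧ 0 < x + y) ∨ (x < 0 ∧ x + y < 0) := by
    have := m60 0
    push_cast at this
    exact this.imp_right fun h => h.resolve_right fun h => by linarith [h.1]
  have m90' : ∀ n : ℤ, (n < 2 * x + y ∧ n < x + 2 * y) ∨ (2 * x + y < n ∧ x + 2 * y < n) := by
    intro n
    have := m90 n
    push_cast at this
    exact this.imp_right fun h => h.resolve_right fun h => by linarith [h.1]
  have m120' := m120 0
  push_cast at m120'
  rcases lt_or_ge w (1 / 2) with hw | hw
  · have m30 := main 1 (e := -1) (f := 1) (s := y - x) (t := -(2 * x + y)) (by norm_num)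
      (by push_cast; linarith) (by push_cast; linarith)
      (fun n => mem_of_eq (hP 1 (-n) n)
        (by simp [show rotA 1 = 0 from rfl, show rotB 1 = 1 from rfl]; ring)
        (by simp [show rotA 1 = 0 from rfl, show rotB 1 = 1 from rfl]; ring) rfl)
      (fun n => mem_of_eq (hQ 1 (-n) n)
        (by simp [show rotA 1 = 0 from rfl, show rotB 1 = 1 from rfl]; ring)
        (by simp [show rotA 1 = 0 from rfl, show rotB 1 = 1 from rfl]; ring) rfl)
      (by ring)
    have m30' : ∀ n : ℤ, (n < y - x ∧ n < -(2 * x + y)) ∨ (y - x < n ∧ -(2 * x + y) < n) := by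
      intro n
      have := m30 n
      push_cast at this
      exact this.imp_right fun h => h.resolve_right fun h => by linarith [h.1]
    have m0 := m30' 0
    push_cast at m0
    rcases m60' with ⟨h1, h2⟩ | ⟨h1, h2⟩
    · have hy : 0 ≤ y := by
        rcases m120' with h | h | h <;> linarith [h.1, h.2]
      have := lt_one_of_forall_int_le (a := x - y) (b := x + 2 * y) fun n hn => by
        have k1 := m90' n
        have k2 := m30' (-n)
        push_cast at k2
        constructor
        · rcases k2 with h | h <;> linarith [h.1, h.2]
        · rcases k1 with h | h <;> linarith [h.1, h.2]
      left
      rcases m0 with h | h <;> refine ⟨?_, ?_, ?_, ?_⟩ <;> linarith [h.1, h.2]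
    · have hy : y ≤ 0 := by
        rcases m120' with h | h | h <;> linarith [h.1, h.2]
      have := lt_one_of_forall_int_le (a := y - x) (b := -(x + 2 * y)) fun n hn => by
        have k1 := m90' (-n)
        have k2 := m30' n
        push_cast at k1
        constructor
        · rcases k2 with h | h <;> linarith [h.1, h.2]
        · rcases k1 with h | h <;> linarith [h.1, h.2]
      right
      rcases m0 with h | h <;> refine ⟨?_, ?_, ?_, ?_⟩ <;> linarith [h.1, h.2]
  · have m150 := main 5 (e := 0) (f := 1) (s := x + 2 * y) (t := y - x) (by norm_num)
      (by push_cast; linarith) (by push_cast; linarith)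
      (fun n => mem_of_eq (hP 5 0 n)
        (by simp [show rotA 5 = 1 from rfl, show rotB 5 = -1 from rfl])
        (by simp [show rotA 5 = 1 from rfl, show rotB 5 = -1 from rfl]; ring) rfl)
      (fun n => mem_of_eq (hQ 5 0 n)
        (by simp [show rotA 5 = 1 from rfl, show rotB 5 = -1 from rfl]; ring)
        (by simp [show rotA 5 = 1 from rfl, show rotB 5 = -1 from rfl]; ring) rfl)
      (by ring)
    have m150' : ∀ n : ℤ, (n ≤ x + 2 * y → n ≤ y - x) ∧ (x + 2 * y ≤ n → y - x ≤ n) := by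
      intro n
      rcases m150 n with h | h | h <;> constructor <;> intro _ <;> linarith [h.1, h.2]
    have m0 := m150' 0
    push_cast at m0
    rcases m60' with ⟨h1, h2⟩ | ⟨h1, h2⟩
    · have hy : 0 < y := by
        rcases m120' with h | h | h <;> linarith [h.1, h.2]
      have := lt_one_of_forall_int_le (a := y - x) (b := 2 * x + y) fun n hn => by
        refine ⟨(m150' n).1 (by linarith), ?_⟩
        rcases m90' n with h | h <;> linarith [h.1, h.2]
      left
      have := m0.1 (by linarith)
      refine ⟨?_, ?_, ?_, ?_⟩ <;> linarith
    · have hy : y < 0 := by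
        rcases m120' with h | h | h <;> linarith [h.1, h.2]
      have := lt_one_of_forall_int_le (a := x - y) (b := -(2 * x + y)) fun n hn => by
        have k1 := m90' (-n)
        have k2 := (m150' (-n)).2
        push_cast at k1 k2
        refine ⟨by linarith [k2 (by linarith)], ?_⟩
        rcases k1 with h | h <;> linarith [h.1, h.2]
      right
      have := m0.2 (by linarith)
      refine ⟨?_, ?_, ?_, ?_⟩ <;> linarith

/-- Screw motions reduce to `0 ≤ w < 1`, by induction on the integer part `r` of `w`. -/
theorem IsNeighbor.fifth_layer_unique_aux (hA : 0 < A) (hB : 0 < B) (hO : IsHexInvariant O)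
    (r : ℤ) : ∀ {u v w : ℝ}, (u, v, w) ∈ O → r ≤ w → w < r + 1 → ∀ {m n m' n' : ℤ},
    IsNeighbor A B O (u, v, w) (u + v + m, -u + n, w + 5) →
    IsNeighbor A B O (u, v, w) (u + v + m', -u + n', w + 5) → m = m' ∧ n = n' := by
  induction r using Int.induction_on with
  | zero =>
    intro u v w hX h0 h1 m n m' n' hn hn'
    push_cast at h0 h1
    have key : ∀ {m n : ℤ}, IsNeighbor A B O (u, v, w) (u + v + m, -u + n, w + 5) →
        _ := fun {m n} hn => by
      -- This translation moves the center of the 60° rotation taking the first point to the second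
      -- to the origin. Two neighbors thus give two lattice translates of one point in an open unit
      -- square, which must coincide.
      have hX' := hO.add_mem hX (-m - n) m
      have hn' := hn.add hO (-m - n) m
      refine IsNeighbor.fifth_layer_cell (w := w) hA hB hO hX' h0 (by linarith) ?_
      convert hn' using 2
      · push_cast; ring
      · congr 1; push_cast; ring
    have k1 := key hn
    have k2 := key hn'
    push_cast at k1 k2
    have e1 : -m - n = -m' - n' := by
      have a1 : ((-m - n - (-m' - n') : ℤ) : ℝ) < (1 : ℤ) := by
        push_cast
        rcases k1 with k1 | k1 <;> rcases k2 with k2 | k2 <;>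
          linarith [k1.1, k1.2.1, k2.1, k2.2.1]
      have a2 : ((-1 : ℤ) : ℝ) < ((-m - n - (-m' - n') : ℤ) : ℝ) := by
        push_cast
        rcases k1 with k1 | k1 <;> rcases k2 with k2 | k2 <;>
          linarith [k1.1, k1.2.1, k2.1, k2.2.1]
      have := Int.cast_lt.1 a1
      have := Int.cast_lt.1 a2
      omega
    have e1' : (-m - n : ℝ) = -m' - n' := by exact_mod_cast e1
    have e2 : m = m' := by
      have a1 : ((m - m' : ℤ) : ℝ) < (1 : ℤ) := by
        push_cast
        rcases k1 with ⟨_, _, _, _⟩ | ⟨_, _, _, _⟩ <;> rcases k2 with ⟨_, _, _, _⟩ | ⟨_, _, _, _⟩ <;>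
          linarith
      have a2 : ((-1 : ℤ) : ℝ) < ((m - m' : ℤ) : ℝ) := by
        push_cast
        rcases k1 with ⟨_, _, _, _⟩ | ⟨_, _, _, _⟩ <;> rcases k2 with ⟨_, _, _, _⟩ | ⟨_, _, _, _⟩ <;>
          linarith
      have := Int.cast_lt.1 a1
      have := Int.cast_lt.1 a2
      omega
    omega
  | succ i ih =>
    intro u v w hX h0 h1 m n m' n' hn hn'
    push_cast at h0 h1
    have key : ∀ {m n : ℤ}, IsNeighbor A B O (u, v, w) (u + v + m, -u + n, w + 5) →
        IsNeighbor A B O (u + v, -u, w - 1)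
          (u + v + -u + (m + n : ℤ), -(u + v) + (-m : ℤ), w - 1 + 5) := fun hn => by
      convert hn.unscrew hO using 2
      · push_cast; ring
      · congr 1
        · push_cast; ring
        · ring
    have := ih (hO.unscrew_mem hX) (by push_cast; linarith) (by push_cast; linarith)
      (key hn) (key hn')
    omega
  | pred i ih =>
    intro u v w hX h0 h1 m n m' n' hn hn'
    push_cast at h0 h1
    have key : ∀ {m n : ℤ}, IsNeighbor A B O (u, v, w) (u + v + m, -u + n, w + 5) →
        IsNeighbor A B O (-v, u + v, w + 1)
          (-v + (u + v) + (-n : ℤ), -(-v) + (m + n : ℤ), w + 1 + 5) := fun hn => by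
      convert hn.screw hO using 2
      · push_cast; ring
      · congr 1
        · push_cast; ring
        · ring
    have := ih (hO.screw_mem hX) (by push_cast; linarith) (by push_cast; linarith)
      (key hn) (key hn')
    omega

theorem IsNeighbor.fifth_layer_unique (hA : 0 < A) (hB : 0 < B) (hO : IsHexInvariant O)
    {u v w : ℝ} (hX : (u, v, w) ∈ O) {m n m' n' : ℤ}
    (hn : IsNeighbor A B O (u, v, w) (u + v + m, -u + n, w + 5))
    (hn' : IsNeighbor A B O (u, v, w) (u + v + m', -u + n', w + 5)) : m = m' ∧ n = n' :=
  fifth_layer_unique_aux hA hB hO ⌊w⌋ hX (Int.floor_le w) (Int.lt_floor_add_one w) hn hn'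

theorem IsNeighbor.fifth_layer_below_unique (hA : 0 < A) (hB : 0 < B) (hO : IsHexInvariant O)
    {u v w : ℝ} (hX : (u, v, w) ∈ O) {m n m' n' : ℤ}
    (hn : IsNeighbor A B O (u, v, w) (-v + m, u + v + n, w - 5))
    (hn' : IsNeighbor A B O (u, v, w) (-v + m', u + v + n', w - 5)) : m = m' ∧ n = n' := by
  have hY : (-v + m, u + v + n, w - 5) ∈ O := by
    refine mem_of_eq (hO.rotLayer_subset hX (-5) ⟨m, n, rfl⟩) ?_ ?_ ?_ <;>
      simp [show rotA (-5) = 0 from rfl, show rotB (-5) = 1 from rfl]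
    ring
  -- Translating the second pair makes both lower points equal; seen from there, the two upper
  -- points lie in the fifth layer above.
  have h2 := (hn'.add hO (m - m') (n - n')).symm
  have := IsNeighbor.fifth_layer_unique hA hB hO hY (m := -m - n) (n := m)
    (m' := -m' - n) (n' := m + n - n') ?_ ?_
  · omega
  · convert hn.symm using 2
    · push_cast; ring
    · congr 1
      · ring
      · ring
  · convert h2 using 2
    · push_cast; ring
    · congr 1; push_cast; ring
    · push_cast; ring
    · congr 1
      · push_cast; ring
      · ring

end Five

/-! ### Counting neighbors layer by layer -/

theorem encard_le_card_of_injOn {α β : Type*} [Fintype β] {s : Set α} (f : α → β)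
    (hf : Set.InjOn f s) : s.encard ≤ Fintype.card β := by
  have := Set.encard_le_encard_of_injOn (t := Set.univ) (fun _ _ => Set.mem_univ _) hf
  simpa [Set.encard_univ] using this

theorem encard_le_sum_of_subset_biUnion {α ι : Type*} {s : Set α} (I : Finset ι) (t : ι → Set α)
    (b : ι → ℕ) (hs : ∀ x ∈ s, ∃ i ∈ I, x ∈ t i) (ht : ∀ i ∈ I, (t i).encard ≤ b i) :
    s.encard ≤ (∑ i ∈ I, b i : ℕ) := by
  classical
  induction I using Finset.induction_on generalizing s with
  | empty =>
    have : s = ∅ := Set.eq_empty_of_forall_notMem fun x hx => by simpa using hs x hx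
    simp [this]
  | insert i I hi ih =>
    have h1 : s ⊆ t i ∪ {x ∈ s | ∃ j ∈ I, x ∈ t j} := by
      intro x hx
      obtain ⟨j, hj, hxj⟩ := hs x hx
      rcases Finset.mem_insert.1 hj with rfl | hj
      · exact Or.inl hxj
      · exact Or.inr ⟨hx, j, hj, hxj⟩
    rw [Finset.sum_insert hi, Nat.cast_add]
    refine (Set.encard_le_encard h1).trans ((Set.encard_union_le _ _).trans ?_)
    exact add_le_add (ht i (Finset.mem_insert_self _ _))
      (ih (fun x hx => hx.2) fun j hj => ht j (Finset.mem_insert_of_mem hj))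

section Counting

variable {A B : ℝ} {O : Set (ℝ × ℝ × ℝ)}

/-- The linear part of a half-turn is an involution, so the relation defining a reflected layer is
symmetric in its two points. -/
theorem rot_symm_formula (j : ℤ) (u v : ℝ) :
    rotA j * ((rotA j * (u + v) + rotB j * v) + (rotB j * (u + v) - (rotA j + rotB j) * v))
      + rotB j * (rotB j * (u + v) - (rotA j + rotB j) * v) = u ∧
    rotB j * ((rotA j * (u + v) + rotB j * v) + (rotB j * (u + v) - (rotA j + rotB j) * v))
      - (rotA j + rotB j) * (rotB j * (u + v) - (rotA j + rotB j) * v) = v := by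
  rcases rotA_rotB_cases j with ⟨ha, hb⟩ | ⟨ha, hb⟩ | ⟨ha, hb⟩ | ⟨ha, hb⟩ | ⟨ha, hb⟩ | ⟨ha, hb⟩ <;>
    rw [ha, hb] <;> push_cast <;> constructor <;> ring

/-- The version of `IsNeighbor.pure_reflection` for neighbors above or below. -/
theorem IsNeighbor.pure_reflection_of_abs (hA : 0 < A) (hB : 0 < B) (hO : IsHexInvariant O)
    {u v w : ℝ} (hX : (u, v, w) ∈ O) {j m n : ℤ} (h3 : 3 < |j - 2 * w|) (h6 : |j - 2 * w| < 6)
    (hn : IsNeighbor A B O (u, v, w) (rotA j * (u + v) + rotB j * v + m,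
      rotB j * (u + v) - (rotA j + rotB j) * v + n, -w + j)) :
    rotA j * (m + n) + rotB j * n = -m ∧ rotB j * (m + n) - (rotA j + rotB j) * n = -n := by
  have hY := hO.reflLayer_subset hX j ⟨m, n, rfl⟩
  rcases le_or_gt 0 (j - 2 * w) with h0 | h0
  · rw [abs_of_nonneg h0] at h3 h6
    exact hn.pure_reflection hA hB hO hX h3 h6
  · rw [abs_of_neg h0] at h3 h6
    simp only at hY
    have := IsNeighbor.pure_reflection hA hB hO hY (j := j) (m := -(rotA j * (m + n) + rotB j * n))
      (n := -(rotB j * (m + n) - (rotA j + rotB j) * n)) (by linarith) (by linarith) (by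
        convert hn.symm using 2
        · have := (rot_symm_formula j u v).1
          push_cast
          linear_combination this
        · congr 1
          · have := (rot_symm_formula j u v).2
            push_cast
            linear_combination this
          · ring)
    rcases rotA_rotB_cases j with ⟨ha, hb⟩ | ⟨ha, hb⟩ | ⟨ha, hb⟩ | ⟨ha, hb⟩ | ⟨ha, hb⟩ | ⟨ha, hb⟩ <;>
      rw [ha, hb] at this ⊢ <;> omega

/-- A set of neighbors in the lattice coset of `(p, q, h)`, parametrized by lattice vectors. -/
theorem encard_coset_le (p q h : ℝ) {s : Set (ℝ × ℝ × ℝ)}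
    {β : Type*} [Fintype β] (f : ℤ × ℤ → β) (hs : ∀ Y ∈ s, ∃ m n : ℤ, Y = (p + m, q + n, h))
    (hf : ∀ m n m' n' : ℤ, (p + m, q + n, h) ∈ s → (p + m', q + n', h) ∈ s →
      f (m, n) = f (m', n') → m = m' ∧ n = n') : s.encard ≤ Fintype.card β := by
  choose! F G hFG using hs
  refine encard_le_card_of_injOn (fun Y => f (F Y, G Y)) fun Y hY Z hZ hYZ => ?_
  have h1 := hFG Y hY
  have h2 := hFG Z hZ
  rw [h1] at hY
  rw [h2] at hZ
  obtain ⟨h3, h4⟩ := hf _ _ _ _ hY hZ hYZ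
  rw [h1, h2, h3, h4]

theorem IsNeighbor.eq_of_parity (hO : IsHexInvariant O) {u v w p q h : ℝ} (hX : (u, v, w) ∈ O)
    {m n m' n' : ℤ} (hY : (p + m, q + n, h) ∈ O)
    (hne : ∀ a b : ℤ, (p + m, q + n, h) ≠ (u + a, v + b, w))
    (h1 : IsNeighbor A B O (u, v, w) (p + m, q + n, h))
    (h2 : IsNeighbor A B O (u, v, w) (p + m', q + n', h))
    (hm : (2 : ℤ) ∣ m' - m) (hn : (2 : ℤ) ∣ n' - n) : m = m' ∧ n = n' := by
  obtain ⟨a, ha⟩ := hm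
  obtain ⟨b, hb⟩ := hn
  have := IsNeighbor.parity (m := a) (n := b) hO hX hY hne h1 (by
    have e1 : (m' : ℝ) = m + 2 * a := by exact_mod_cast (by omega : m' = m + 2 * a)
    have e2 : (n' : ℝ) = n + 2 * b := by exact_mod_cast (by omega : n' = n + 2 * b)
    rw [e1, e2] at h2
    convert h2 using 2
    · ring
    · congr 1; ring)
  omega

theorem two_dvd_sub_of_cast_eq {m n : ℤ} (h : (m : ZMod 2) = n) : (2 : ℤ) ∣ n - m :=
  (ZMod.intCast_eq_intCast_iff_dvd_sub m n 2).1 h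

/-- The neighbors of `X` in `O`. -/
def neighborSet (A B : ℝ) (O : Set (ℝ × ℝ × ℝ)) (X : ℝ × ℝ × ℝ) : Set (ℝ × ℝ × ℝ) :=
  {Y | Y ∈ O ∧ IsNeighbor A B O X Y}

/-- By parity, lattice parameters of neighbors are distinct modulo 2. The coset of the point itself
is excluded, since the parity argument fails there. -/
theorem encard_neighborSet_coset_le_four (hO : IsHexInvariant O) {u v w : ℝ}
    (hX : (u, v, w) ∈ O) (p q h : ℝ) {s : Set (ℝ × ℝ × ℝ)} (hs : s ⊆ neighborSet A B O (u, v, w))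
    (hs' : ∀ Y ∈ s, ∃ m n : ℤ, Y = (p + m, q + n, h))
    (hne : ∀ Y ∈ s, ∀ a b : ℤ, Y ≠ (u + a, v + b, w)) : s.encard ≤ 4 := by
  refine encard_coset_le p q h (fun x => ((x.1 : ZMod 2), (x.2 : ZMod 2))) hs' ?_
  intro m n m' n' h1 h2 heq
  simp only [Prod.mk.injEq] at heq
  exact IsNeighbor.eq_of_parity hO hX (hs h1).1 (hne _ h1) (hs h1).2 (hs h2).2
    (two_dvd_sub_of_cast_eq heq.1) (two_dvd_sub_of_cast_eq heq.2)

/-- With no glide, the lattice parameters satisfy a linear relation which makes the parity of one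
suitable coordinate determine that of both. -/
theorem encard_neighborSet_reflLayer_le_two (hA : 0 < A) (hB : 0 < B) (hO : IsHexInvariant O)
    {u v w : ℝ} (hX : (u, v, w) ∈ O) {j : ℤ} (h3 : 3 < |j - 2 * w|) (h6 : |j - 2 * w| < 6) :
    (neighborSet A B O (u, v, w) ∩ reflLayer (u, v, w) j).encard ≤ 2 := by
  have hne : ∀ m n : ℤ, ∀ a b : ℤ, ((rotA j * (u + v) + rotB j * v + m,
      rotB j * (u + v) - (rotA j + rotB j) * v + n, -w + j) : ℝ × ℝ × ℝ) ≠ (u + a, v + b, w) := by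
    intro m n a b h
    simp only [Prod.mk.injEq] at h
    have : (j : ℝ) - 2 * w = 0 := by linarith [h.2.2]
    rw [this] at h3
    norm_num at h3
  have key : ∀ f : ℤ × ℤ → ZMod 2, (∀ m n m' n' : ℤ,
      (rotA j * (m + n) + rotB j * n = -m ∧ rotB j * (m + n) - (rotA j + rotB j) * n = -n) →
      (rotA j * (m' + n') + rotB j * n' = -m' ∧
        rotB j * (m' + n') - (rotA j + rotB j) * n' = -n') →
      f (m, n) = f (m', n') → (2 : ℤ) ∣ m' - m ∧ (2 : ℤ) ∣ n' - n) →
      (neighborSet A B O (u, v, w) ∩ reflLayer (u, v, w) j).encard ≤ 2 := by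
    intro f hf
    refine encard_coset_le (rotA j * (u + v) + rotB j * v)
      (rotB j * (u + v) - (rotA j + rotB j) * v) (-w + j) f (fun Y hY => hY.2) ?_
    intro m n m' n' h1 h2 heq
    obtain ⟨k1, k2⟩ := hf m n m' n' (h1.1.2.pure_reflection_of_abs hA hB hO hX h3 h6)
      (h2.1.2.pure_reflection_of_abs hA hB hO hX h3 h6) heq
    exact IsNeighbor.eq_of_parity hO hX h1.1.1 (hne m n) h1.1.2 h2.1.2 k1 k2
  have hc : ∀ {a b : ℤ}, (a : ZMod 2) = b → (2 : ℤ) ∣ b - a := two_dvd_sub_of_cast_eq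
  rcases rotA_rotB_cases j with ⟨ha, hb⟩ | ⟨ha, hb⟩ | ⟨ha, hb⟩ | ⟨ha, hb⟩ | ⟨ha, hb⟩ | ⟨ha, hb⟩
  all_goals
    first
    | refine key (fun x => x.1) fun m n m' n' h1 h2 h => ?_
      rw [ha, hb] at h1 h2
      have := hc h
      omega
    | refine key (fun x => x.2) fun m n m' n' h1 h2 h => ?_
      rw [ha, hb] at h1 h2
      have := hc h
      omega

/-- Within its own horizontal layer a point has at most six neighbors, given by the minimal vectors
of the hexagonal lattice. -/
theorem encard_neighborSet_rotLayer_zero (hA : 0 < A) (hO : IsHexInvariant O) {u v w : ℝ}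
    (hX : (u, v, w) ∈ O) : (neighborSet A B O (u, v, w) ∩ rotLayer (u, v, w) 0).encard ≤ 6 := by
  have key : neighborSet A B O (u, v, w) ∩ rotLayer (u, v, w) 0 ⊆
      ((({(1, 0), (-1, 0), (0, 1), (0, -1), (1, -1), (-1, 1)} : Finset (ℤ × ℤ)).image
        fun x : ℤ × ℤ => ((u + x.1, v + x.2, w) : ℝ × ℝ × ℝ) : Finset (ℝ × ℝ × ℝ)) :
          Set (ℝ × ℝ × ℝ)) := by
    rintro Y ⟨⟨-, hn⟩, m, n, rfl⟩
    simp only [rotA_zero, rotB_zero, Int.cast_one, Int.cast_zero, one_mul, zero_mul, sub_zero,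
      zero_add, add_zero] at hn ⊢
    rw [Finset.coe_image]
    refine ⟨(m, n), ?_, rfl⟩
    obtain ⟨hne, ⟨x, y, z⟩, e, f⟩ := hn
    have h0 : ¬ (m = 0 ∧ n = 0) := fun h => hne (by simp [h.1, h.2])
    -- The pairs `0, (m, n)` and `(a, b), (m - a, n - b)` have the same midpoint, so the neighbor
    -- pair is strictly shorter. Testing this with the six minimal vectors forces `(m, n)` to be one
    -- of them.
    have main : ∀ a b : ℤ, ¬ (a = 0 ∧ b = 0) → ¬ (a = m ∧ b = n) →
        2 * a * m + a * n + b * m + 2 * b * n < 2 * (a ^ 2 + a * b + b ^ 2) := by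
      intro a b h1 h2
      have k1 := f (u + a, v + b, w) (hO.add_mem hX a b)
        (fun h => h1 (by simpa using h)) (fun h => h2 (by simpa using h))
      have k2 := f (u + (m - a : ℤ), v + (n - b : ℤ), w) (hO.add_mem hX _ _)
        (fun h => h2 (by
          simp only [Prod.mk.injEq, add_eq_left, Int.cast_eq_zero, and_true] at h; omega))
        (fun h => h1 (by
          simp only [Prod.mk.injEq, add_right_inj, Int.cast_inj, and_true] at h; omega))
      simp only [hexDist] at e k1 k2
      push_cast at k2
      have : 0 < A * (2 * (a ^ 2 + a * b + b ^ 2) -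
          (2 * a * m + a * n + b * m + 2 * b * n) : ℝ) := by linear_combination k1 + k2 - e
      have := (pos_iff_pos_of_mul_pos this).1 hA
      have : (2 * a * m + a * n + b * m + 2 * b * n : ℝ) < 2 * (a ^ 2 + a * b + b ^ 2) := by
        linarith
      exact_mod_cast this
    by_contra hc
    simp only [Finset.coe_insert, Finset.coe_singleton, Set.mem_insert_iff, Prod.mk.injEq,
      Set.mem_singleton_iff, not_or] at hc
    have m1 := main 1 0 (by omega) (by omega)
    have m2 := main (-1) 0 (by omega) (by omega)
    have m3 := main 0 1 (by omega) (by omega)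
    have m4 := main 0 (-1) (by omega) (by omega)
    have m5 := main 1 (-1) (by omega) (by omega)
    have m6 := main (-1) 1 (by omega) (by omega)
    omega
  refine (Set.encard_le_encard key).trans ?_
  rw [Set.encard_coe_eq_coe_finsetCard]
  exact_mod_cast Finset.card_image_le

/-- The center is within height 3 of both points. -/
theorem IsNeighbor.abs_height_lt (hB : 0 < B) (hO : IsHexInvariant O) {u v w u' v' w' : ℝ}
    (hX : (u, v, w) ∈ O) (hY : (u', v', w') ∈ O)
    (h6 : (u', v', w') ≠ (u, v, w + 6)) (h6' : (u', v', w') ≠ (u, v, w - 6))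
    (hn : IsNeighbor A B O (u, v, w) (u', v', w')) : |w' - w| < 6 := by
  obtain ⟨-, ⟨x, y, z⟩, e1, f1⟩ := hn
  have k1 := IsNeighbor.center_height hB hO hX h6 h6' f1
  have k2 := IsNeighbor.center_height (u' := u) (v' := v) (w' := w) hB hO hY
    (fun h => h6' (by
      simp only [Prod.mk.injEq] at h ⊢; refine ⟨h.1.symm, h.2.1.symm, by linarith [h.2.2]⟩))
    (fun h => h6 (by
      simp only [Prod.mk.injEq] at h ⊢; refine ⟨h.1.symm, h.2.1.symm, by linarith [h.2.2]⟩))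
    (fun W hW h1 h2 => by rw [← e1]; exact f1 W hW h2 h1)
  rw [abs_lt]
  constructor <;> linarith

theorem encard_neighborSet_rotLayers (hA : 0 < A) (hB : 0 < B) (hO : IsHexInvariant O)
    {u v w : ℝ} (hX : (u, v, w) ∈ O) :
    {Y ∈ neighborSet A B O (u, v, w) | ∃ k ∈ Finset.Icc (-5 : ℤ) 5,
      Y ∈ rotLayer (u, v, w) k}.encard ≤ 40 := by
  refine (encard_le_sum_of_subset_biUnion (Finset.Icc (-5 : ℤ) 5)
    (fun k => neighborSet A B O (u, v, w) ∩ rotLayer (u, v, w) k)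
    (fun k => if k = 0 then 6 else if k = 5 ∨ k = -5 then 1 else 4)
    (fun Y hY => ⟨_, hY.2.choose_spec.1, hY.1, hY.2.choose_spec.2⟩) ?_).trans (le_of_eq (by rfl))
  intro k hk
  split_ifs with h0 h5
  · subst h0
    exact encard_neighborSet_rotLayer_zero hA hO hX
  · rw [Nat.cast_one, Set.encard_le_one_iff]
    rintro _ _ ⟨⟨-, h1⟩, m, n, rfl⟩ ⟨⟨-, h2⟩, m', n', rfl⟩
    rcases h5 with rfl | rfl
    · simp only [show rotA 5 = 1 from rfl, show rotB 5 = -1 from rfl] at h1 h2 ⊢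
      obtain ⟨rfl, rfl⟩ := IsNeighbor.fifth_layer_unique hA hB hO hX (m := m) (n := n) (m' := m')
        (n' := n') (by convert h1 using 3 <;> push_cast <;> ring)
        (by convert h2 using 3 <;> push_cast <;> ring)
      rfl
    · simp only [show rotA (-5) = 0 from rfl, show rotB (-5) = 1 from rfl] at h1 h2 ⊢
      obtain ⟨rfl, rfl⟩ := IsNeighbor.fifth_layer_below_unique hA hB hO hX (m := m) (n := n)
        (m' := m') (n' := n') (by convert h1 using 3 <;> push_cast <;> ring)
        (by convert h2 using 3 <;> push_cast <;> ring)
      rfl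
  · refine encard_neighborSet_coset_le_four hO hX _ _ _ Set.inter_subset_left
      (fun Y hY => hY.2) ?_
    rintro _ ⟨-, m, n, rfl⟩ a b h
    simp only [Prod.mk.injEq, add_eq_left, Int.cast_eq_zero] at h
    exact h0 h.2.2

/-- When `2 * w` is an integer, a reflected layer may coincide with the point's own coset; such
points are counted in `rotLayer` 0 and excluded here. -/
theorem encard_neighborSet_reflLayers (hA : 0 < A) (hB : 0 < B) (hO : IsHexInvariant O)
    {u v w : ℝ} (hX : (u, v, w) ∈ O) :
    {Y ∈ neighborSet A B O (u, v, w) | Y ∉ rotLayer (u, v, w) 0 ∧ ∃ k : ℤ, |k - 2 * w| < 6 ∧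
      Y ∈ reflLayer (u, v, w) k}.encard ≤ 36 := by
  have hfour : ∀ k : ℤ, ({Y ∈ neighborSet A B O (u, v, w) | Y ∉ rotLayer (u, v, w) 0 ∧
      |k - 2 * w| < 6 ∧ Y ∈ reflLayer (u, v, w) k}).encard ≤ 4 := by
    intro k
    refine encard_neighborSet_coset_le_four hO hX _ _ _ (fun Y hY => hY.1)
      (fun Y hY => hY.2.2.2) ?_
    rintro Y hY a b rfl
    refine hY.2.1 ⟨a, b, ?_⟩
    simp [rotA_zero, rotB_zero]
  have htwo : ∀ k : ℤ, 3 < |k - 2 * w| → ({Y ∈ neighborSet A B O (u, v, w) |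
      Y ∉ rotLayer (u, v, w) 0 ∧ |k - 2 * w| < 6 ∧ Y ∈ reflLayer (u, v, w) k}).encard ≤ 2 := by
    intro k h3
    by_cases h6 : |k - 2 * w| < 6
    · exact (Set.encard_le_encard (t := neighborSet A B O (u, v, w) ∩ reflLayer (u, v, w) k)
        fun Y hY => ⟨hY.1, hY.2.2.2⟩).trans
        (encard_neighborSet_reflLayer_le_two hA hB hO hX h3 h6)
    · simp [h6]
  have f1 := Int.floor_le (2 * w)
  have f2 := Int.lt_floor_add_one (2 * w)
  have hcover : ∀ Y ∈ {Y ∈ neighborSet A B O (u, v, w) | Y ∉ rotLayer (u, v, w) 0 ∧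
      ∃ k : ℤ, |k - 2 * w| < 6 ∧ Y ∈ reflLayer (u, v, w) k}, ∃ i ∈ Finset.Icc (-5 : ℤ) 6,
      Y ∈ {Y ∈ neighborSet A B O (u, v, w) | Y ∉ rotLayer (u, v, w) 0 ∧
        |((⌊2 * w⌋ + i : ℤ) : ℝ) - 2 * w| < 6 ∧ Y ∈ reflLayer (u, v, w) (⌊2 * w⌋ + i)} := by
    rintro Y ⟨h1, h2, k, h3, h4⟩
    refine ⟨k - ⌊2 * w⌋, ?_, h1, h2, ?_⟩
    · rw [abs_lt] at h3
      rw [Finset.mem_Icc]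
      have a1 : (-6 : ℤ) < k - ⌊2 * w⌋ := by
        have : ((-6 : ℤ) : ℝ) < ((k - ⌊2 * w⌋ : ℤ) : ℝ) := by push_cast; linarith [h3.1]
        exact Int.cast_lt.1 this
      have a2 : k - ⌊2 * w⌋ < 7 := by
        have : ((k - ⌊2 * w⌋ : ℤ) : ℝ) < ((7 : ℤ) : ℝ) := by push_cast; linarith [h3.2]
        exact Int.cast_lt.1 this
      omega
    · rw [add_sub_cancel]
      exact ⟨h3, h4⟩
  rcases f1.eq_or_lt with h0 | h0
  -- `2 * w` is an integer: relative heights `-5, …, 5`, and 7·4 + 4·2 = 36; the index 6 is void.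
  · refine (encard_le_sum_of_subset_biUnion _ _
      (fun i => if i = 6 then 0 else if -3 ≤ i ∧ i ≤ 3 then 4 else 2) hcover ?_).trans
        (le_of_eq (by rfl))
    intro i hi
    split_ifs with h6 h3
    · subst h6
      have : ¬ |((⌊2 * w⌋ + 6 : ℤ) : ℝ) - 2 * w| < 6 := by
        push_cast
        rw [h0]
        norm_num
      exact (Set.encard_eq_zero.2 (Set.eq_empty_of_forall_notMem fun Y hY =>
        this hY.2.2.1)).trans_le zero_le
    · exact hfour _
    · refine htwo _ ?_
      push_cast
      rw [h0, add_sub_cancel_left]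
      have : 3 < |i| := by
        rw [lt_abs]; omega
      exact_mod_cast this
  -- `2 * w` is not an integer: twelve layers, six at relative height below 3 in absolute value, and
  -- 6·4 + 6·2 = 36.
  · refine (encard_le_sum_of_subset_biUnion _ _
      (fun i => if -2 ≤ i ∧ i ≤ 3 then 4 else 2) hcover ?_).trans (le_of_eq (by rfl))
    intro i hi
    split_ifs with h3
    · exact hfour _
    · refine htwo _ ?_
      push_cast
      rw [lt_abs]
      have : i ≤ -3 ∨ 4 ≤ i := by omega
      rcases this with h | h
      · right
        have : (i : ℝ) ≤ -3 := by exact_mod_cast h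
        linarith
      · left
        have : (4 : ℝ) ≤ i := by exact_mod_cast h
        linarith

/-- A point has at most 78 Voronoi neighbors in its `P6₁22`-orbit. -/
theorem encard_neighborSet_le (hA : 0 < A) (hB : 0 < B) (hO : IsHexInvariant O)
    {X : ℝ × ℝ × ℝ} (hX : X ∈ O) (hO' : O ⊆ hexOrbit X) : (neighborSet A B O X).encard ≤ 78 := by
  obtain ⟨u, v, w⟩ := X
  have hsub : neighborSet A B O (u, v, w) ⊆
      ({(u, v, w + 6), (u, v, w - 6)} ∪
      {Y ∈ neighborSet A B O (u, v, w) | ∃ k ∈ Finset.Icc (-5 : ℤ) 5,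
        Y ∈ rotLayer (u, v, w) k}) ∪
      {Y ∈ neighborSet A B O (u, v, w) | Y ∉ rotLayer (u, v, w) 0 ∧ ∃ k : ℤ, |k - 2 * w| < 6 ∧
        Y ∈ reflLayer (u, v, w) k} := by
    intro Y hY
    by_cases h6 : Y = (u, v, w + 6)
    · exact Or.inl (Or.inl (Or.inl h6))
    by_cases h6' : Y = (u, v, w - 6)
    · exact Or.inl (Or.inl (Or.inr h6'))
    by_cases h0 : Y ∈ rotLayer (u, v, w) 0
    · exact Or.inl (Or.inr ⟨hY, 0, by simp, h0⟩)
    have hlt := IsNeighbor.abs_height_lt (u' := Y.1) (v' := Y.2.1) (w' := Y.2.2) hB hO hX hY.1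
      h6 h6' hY.2
    obtain ⟨k, hk | hk⟩ := hO' hY.1
    · refine Or.inl (Or.inr ⟨hY, k, ?_, hk⟩)
      obtain ⟨m, n, rfl⟩ := hk
      rw [add_sub_cancel_left] at hlt
      have : |k| < 6 := by exact_mod_cast hlt
      rw [abs_lt] at this
      rw [Finset.mem_Icc]
      omega
    · refine Or.inr ⟨hY, h0, k, ?_, hk⟩
      obtain ⟨m, n, rfl⟩ := hk
      convert hlt using 2
      ring
  have hpair : ({(u, v, w + 6), (u, v, w - 6)} : Set (ℝ × ℝ × ℝ)).encard ≤ 2 := by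
    refine (Set.encard_insert_le _ _).trans ?_
    rw [Set.encard_singleton]
    norm_num
  refine (Set.encard_le_encard hsub).trans ((Set.encard_union_le _ _).trans ?_)
  refine (add_le_add ((Set.encard_union_le _ _).trans (add_le_add (b := 2) hpair
    (encard_neighborSet_rotLayers hA hB hO hX))) (encard_neighborSet_reflLayers hA hB hO hX)).trans
      ?_
  norm_num

end Counting

/-! ### Facets of a Voronoi region and neighbors of its site -/

/-- The points of `S` whose Voronoi region shares with that of `P` a point lying in no other
region. -/
def voronoiNeighbors (S : Set E3) (P : E3) : Set E3 :=
  {Q ∈ S | Q ≠ P ∧ ∃ x, dist x P = dist x Q ∧ ∀ R ∈ S, R ≠ P → R ≠ Q → dist x P < dist x R}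

theorem dist_sq_sub_dist_sq (x P Q : E3) :
    dist x Q ^ 2 - dist x P ^ 2 = ‖Q‖ ^ 2 - ‖P‖ ^ 2 - 2 * inner ℝ (Q - P) x := by
  rw [dist_eq_norm, dist_eq_norm, norm_sub_sq_real, norm_sub_sq_real, inner_sub_left,
    real_inner_comm x Q, real_inner_comm x P]
  ring

theorem dist_le_dist_iff_inner (x P Q : E3) :
    dist x P ≤ dist x Q ↔ inner ℝ (Q - P) x ≤ (‖Q‖ ^ 2 - ‖P‖ ^ 2) / 2 := by
  rw [← sq_le_sq₀ dist_nonneg dist_nonneg, ← sub_nonneg, dist_sq_sub_dist_sq]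
  constructor <;> intro h <;> linarith

theorem dist_eq_dist_iff_inner (x P Q : E3) :
    dist x P = dist x Q ↔ inner ℝ (Q - P) x = (‖Q‖ ^ 2 - ‖P‖ ^ 2) / 2 := by
  rw [← sq_eq_sq₀ dist_nonneg dist_nonneg, ← sub_eq_zero, ← neg_eq_zero, neg_sub,
    dist_sq_sub_dist_sq]
  constructor <;> intro h <;> linarith

section Facets

variable {S : Set E3} {P : E3}

theorem convex_voronoiRegion (S : Set E3) (P : E3) : Convex ℝ (voronoiRegion S P) := by
  intro x hx y hy a b ha hb hab Q hQ
  have h1 := (dist_le_dist_iff_inner x P Q).1 (hx Q hQ)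
  have h2 := (dist_le_dist_iff_inner y P Q).1 (hy Q hQ)
  rw [dist_le_dist_iff_inner, inner_add_right, inner_smul_right, inner_smul_right]
  calc _ ≤ a * ((‖Q‖ ^ 2 - ‖P‖ ^ 2) / 2) + b * ((‖Q‖ ^ 2 - ‖P‖ ^ 2) / 2) := by gcongr
    _ = _ := by rw [← add_mul, hab, one_mul]

/-- Near `x` only the finitely many sites within `dist x P + 2` matter, and for each of them the
strict inequality is an open condition. -/
theorem eventually_dist_lt (hS : ∀ x r, {Q ∈ S | dist x Q ≤ r}.Finite) (P x : E3) :
    ∀ᶠ y in nhds x, ∀ R ∈ S, dist x P < dist x R → dist y P < dist y R := by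
  have h1 : ∀ᶠ y in nhds x, ∀ R ∈ {Q ∈ S | dist x Q ≤ dist x P + 2},
      dist x P < dist x R → dist y P < dist y R := by
    rw [Filter.eventually_all_finite (hS _ _)]
    intro R _
    by_cases h : dist x P < dist x R
    · have : ∀ᶠ y in nhds x, dist y P < dist y R :=
        (continuous_id.dist continuous_const).continuousAt.eventually_lt
          (continuous_id.dist continuous_const).continuousAt h
      exact this.mono fun y hy _ => hy
    · exact Filter.Eventually.of_forall fun y hy => absurd hy h
  filter_upwards [h1, Metric.ball_mem_nhds x one_pos] with y hy hyx R hR hlt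
  by_cases h : dist x R ≤ dist x P + 2
  · exact hy R ⟨hR, h⟩ hlt
  · have a1 := dist_triangle x y R
    have a2 := dist_triangle y x P
    rw [Metric.mem_ball] at hyx
    rw [dist_comm x y] at a1
    linarith

theorem exists_eq_bisector_of_mem_facets (hS : ∀ x r, {Q ∈ S | dist x Q ≤ r}.Finite)
    {F : Set E3} (hF : F ∈ facets (voronoiRegion S P)) :
    ∃ Q ∈ voronoiNeighbors S P, F = voronoiRegion S P ∩ {y | dist y P = dist y Q} := by
  obtain ⟨hexp, hrank⟩ := hF
  have hconv : Convex ℝ F := hexp.convex (convex_voronoiRegion S P)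
  have hFne : F.Nonempty := by
    rw [Set.nonempty_iff_ne_empty]
    rintro rfl
    rw [vectorSpan_empty, finrank_bot] at hrank
    omega
  obtain ⟨l, hl⟩ := hexp hFne
  have hFK : F ⊆ voronoiRegion S P := fun y hy => by rw [hl] at hy; exact hy.1
  obtain ⟨t, htF, htspan, htind⟩ := exists_affineIndependent ℝ E3 F
  have htfin : t.Finite := finite_set_of_fin_dim_affineIndependent ℝ htind
  have htne : t.Nonempty := by
    rw [← affineSpan_nonempty ℝ, htspan, affineSpan_nonempty]
    exact hFne
  obtain ⟨T, rfl⟩ := htfin.exists_finset_coe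
  have hTcard : 0 < (T.card : ℝ) := by
    exact_mod_cast Finset.card_pos.2 (by exact_mod_cast htne)
  -- The centroid of an affine basis of `F` serves as a relatively interior point: an inequality
  -- valid on `F` and tight at `x` is tight on the basis, hence on all of `F`.
  set x : E3 := ∑ a ∈ T, (T.card : ℝ)⁻¹ • a with hx
  have hxF : x ∈ F := hconv.sum_mem (fun _ _ => by positivity) (by
    rw [Finset.sum_const, nsmul_eq_mul, mul_inv_cancel₀ hTcard.ne']) fun a ha => htF ha
  have hactive : ∀ Q ∈ S, dist x P = dist x Q → ∀ y ∈ F, dist y P = dist y Q := by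
    intro Q hQ hxQ y hy
    have h1 : ∀ a ∈ T, inner ℝ (Q - P) a ≤ (‖Q‖ ^ 2 - ‖P‖ ^ 2) / 2 := fun a ha =>
      (dist_le_dist_iff_inner a P Q).1 (hFK (htF ha) Q hQ)
    rw [dist_eq_dist_iff_inner, hx, inner_sum] at hxQ
    simp only [inner_smul_right] at hxQ
    have h2 : ∑ a ∈ T, inner ℝ (Q - P) a = ∑ a ∈ T, (‖Q‖ ^ 2 - ‖P‖ ^ 2) / 2 := by
      rw [← Finset.mul_sum] at hxQ
      rw [Finset.sum_const, nsmul_eq_mul, ← hxQ]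
      field_simp
    rw [Finset.sum_eq_sum_iff_of_le h1] at h2
    have hy' : y ∈ affineSpan ℝ (T : Set E3) := htspan ▸ subset_affineSpan ℝ F hy
    rw [dist_eq_dist_iff_inner]
    refine affineSpan_induction (p := fun y => inner ℝ (Q - P) y = (‖Q‖ ^ 2 - ‖P‖ ^ 2) / 2) hy'
      (fun a ha => h2 a ha) ?_
    intro c u v w hu hv hw
    simp only [vsub_eq_sub, vadd_eq_add] at *
    rw [inner_add_right, inner_smul_right, inner_sub_right, hu, hv, hw]
    ring
  have hev := eventually_dist_lt hS P x
  -- The exposing functional is maximal at `x`, so it vanishes along any direction in which one can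
  -- move both ways.
  have hmax : ∀ d : E3, (∀ᶠ s : ℝ in nhds 0, x + s • d ∈ voronoiRegion S P) → l d = 0 := by
    intro d hd
    obtain ⟨ε, hε, hball⟩ := Metric.eventually_nhds_iff.1 hd
    rw [hl] at hxF
    have k1 := hxF.2 _ (hball (y := ε / 2) (by
      rw [dist_zero_right, Real.norm_eq_abs, abs_of_pos (by positivity)]; linarith))
    have k2 := hxF.2 _ (hball (y := -(ε / 2)) (by
      rw [dist_zero_right, Real.norm_eq_abs, abs_neg, abs_of_pos (by positivity)]; linarith))
    rw [map_add, map_smul, smul_eq_mul] at k1 k2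
    have e1 : ε / 2 * l d ≤ 0 := by linarith
    have e2 : 0 ≤ ε / 2 * l d := by linarith
    have := le_antisymm e1 e2
    rcases mul_eq_zero.1 this with h | h
    · linarith
    · exact h
  have hline : ∀ d : E3, Filter.Tendsto (fun s : ℝ => x + s • d) (nhds 0) (nhds x) := by
    intro d
    have : Continuous fun s : ℝ => x + s • d := by fun_prop
    simpa using this.tendsto 0
  have hxK := hFK hxF
  -- If no bisector passed through `x`, then `x` would be interior, the functional zero, and `F`
  -- three-dimensional.
  obtain ⟨Q, hQS, hQP, hxQ⟩ : ∃ Q ∈ S, Q ≠ P ∧ dist x P = dist x Q := by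
    by_contra hno
    push Not at hno
    have hnhds : ∀ᶠ y in nhds x, y ∈ voronoiRegion S P := by
      filter_upwards [hev] with y hy R hR
      by_cases hRP : R = P
      · rw [hRP]
      · exact (hy R hR (lt_of_le_of_ne (hxK R hR) (hno R hR hRP))).le
    have hl0 : ∀ d, l d = 0 := fun d => hmax d ((hline d).eventually hnhds)
    have hFeq : F = voronoiRegion S P := by
      refine hFK.antisymm fun y hy => ?_
      rw [hl]
      exact ⟨hy, fun z _ => by rw [hl0, hl0]⟩
    have hint : (interior F).Nonempty := ⟨x, by rw [hFeq]; exact mem_interior_iff_mem_nhds.2 hnhds⟩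
    have htop := affineSpan_eq_top_of_nonempty_interior
      (hint.mono (interior_mono (subset_convexHull ℝ F)))
    rw [← direction_affineSpan, htop, AffineSubspace.direction_top, finrank_top] at hrank
    simp at hrank
  have horth : ∀ R ∈ S, dist x P = dist x R → R - P ∈ (vectorSpan ℝ F)ᗮ := by
    intro R hR hxR
    rw [Submodule.mem_orthogonal']
    intro u hu
    refine Submodule.span_induction (p := fun u _ => inner ℝ (R - P) u = 0) ?_ (by simp) ?_ ?_ hu
    · rintro _ ⟨a, ha, b, hb, rfl⟩
      have h1 := (dist_eq_dist_iff_inner _ _ _).1 (hactive R hR hxR a ha)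
      have h2 := (dist_eq_dist_iff_inner _ _ _).1 (hactive R hR hxR b hb)
      simp only [vsub_eq_sub]
      rw [inner_sub_right, h1, h2, sub_self]
    · intro a b _ _ ha hb
      rw [inner_add_right, ha, hb, add_zero]
    · intro c a _ ha
      rw [inner_smul_right, ha, mul_zero]
  have hrank1 : Module.finrank ℝ (vectorSpan ℝ F)ᗮ = 1 := by
    have := (vectorSpan ℝ F).finrank_add_finrank_orthogonal
    rw [hrank, finrank_euclideanSpace_fin] at this
    omega
  -- All `R - P` with `R` tight at `x` lie on the line orthogonal to `F`, and a line through `P`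
  -- meets the sphere about `x` through `P` in only one further point.
  have huniq : ∀ R ∈ S, R ≠ P → dist x P = dist x R → R = Q := by
    intro R hR hRP hxR
    obtain ⟨c, hc⟩ := (finrank_eq_one_iff_of_nonzero' (⟨Q - P, horth Q hQS hxQ⟩ : (vectorSpan ℝ F)ᗮ)
      (by simpa [Subtype.ext_iff, sub_eq_zero] using hQP)).1 hrank1 ⟨R - P, horth R hR hxR⟩
    have hc' : R - P = c • (Q - P) := by
      have := congrArg Subtype.val hc
      simpa using this.symm
    have key : ∀ Z : E3, dist x P = dist x Z → 2 * inner ℝ (Z - P) (x - P) = ‖Z - P‖ ^ 2 := by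
      intro Z hZ
      have : x - Z = (x - P) - (Z - P) := by abel
      rw [dist_eq_norm, dist_eq_norm, this] at hZ
      have h2 := norm_sub_sq_real (x - P) (Z - P)
      rw [← hZ, real_inner_comm] at h2
      linarith
    have k1 := key Q hxQ
    have k2 := key R hxR
    have hpos : 0 < ‖Q - P‖ ^ 2 := by
      have := norm_pos_iff.2 (sub_ne_zero.2 hQP)
      positivity
    have hc0 : c ≠ 0 := by
      rintro rfl
      rw [zero_smul, sub_eq_zero] at hc'
      exact hRP hc'
    rw [hc', norm_smul, inner_smul_left, mul_pow, Real.norm_eq_abs, sq_abs] at k2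
    simp only [conj_trivial] at k2
    have hc1 : c = 1 := by
      have : c * (c - 1) * ‖Q - P‖ ^ 2 = 0 := by linear_combination c * k1 - k2
      rcases mul_eq_zero.1 this with h | h
      · rcases mul_eq_zero.1 h with h | h
        · exact absurd h hc0
        · linarith
      · exact absurd h hpos.ne'
    rw [hc1, one_smul] at hc'
    exact sub_left_injective hc'
  refine ⟨Q, ⟨hQS, hQP, x, hxQ, fun R hR hRP hRQ =>
    lt_of_le_of_ne (hxK R hR) fun h => hRQ (huniq R hR hRP h)⟩, ?_⟩
  refine Set.Subset.antisymm (fun y hy => ⟨hFK hy, hactive Q hQS hxQ y hy⟩) ?_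
  rintro y ⟨hyK, hyQ⟩
  -- On the line through `x` and `y` the `Q`-inequality stays an equality and the others remain
  -- strict near `x`, so one can move both ways from `x`.
  have hd : l (y - x) = 0 := by
    refine hmax _ ?_
    filter_upwards [(hline (y - x)).eventually hev] with s hs R hR
    by_cases hRP : R = P
    · rw [hRP]
    by_cases hRQ : R = Q
    · rw [hRQ]
      refine le_of_eq ?_
      have hyQ' := (dist_eq_dist_iff_inner y P Q).1 hyQ
      rw [dist_eq_dist_iff_inner] at hxQ ⊢
      rw [inner_add_right, inner_smul_right, inner_sub_right, hyQ', hxQ]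
      ring
    · exact (hs R hR (lt_of_le_of_ne (hxK R hR) fun h => hRQ (huniq R hR hRP h))).le
  rw [map_sub, sub_eq_zero] at hd
  rw [hl] at hxF ⊢
  exact ⟨hyK, fun z hz => by rw [hd]; exact hxF.2 z hz⟩

theorem encard_facets_le (hS : ∀ x r, {Q ∈ S | dist x Q ≤ r}.Finite) (P : E3) :
    (facets (voronoiRegion S P)).encard ≤ (voronoiNeighbors S P).encard := by
  have : facets (voronoiRegion S P) ⊆
      (fun Q => voronoiRegion S P ∩ {y | dist y P = dist y Q}) '' voronoiNeighbors S P := by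
    intro F hF
    obtain ⟨Q, hQ, rfl⟩ := exists_eq_bisector_of_mem_facets hS hF
    exact ⟨Q, hQ, rfl⟩
  exact (Set.encard_le_encard this).trans (Set.encard_image_le _ _)

end Facets

/-! ### Hexagonal coordinates and the generators -/

/-- Space in the coordinates adapted to `groupP6122 l (6 * a)`. -/
noncomputable def hexCoord (l a : ℝ) (X : ℝ × ℝ × ℝ) : E3 :=
  !₂[l * (X.1 + X.2.1 / 2), √3 / 2 * l * X.2.1, a * X.2.2]

section Coordinates

variable {l a : ℝ}

theorem dist_hexCoord (l a : ℝ) (X Y : ℝ × ℝ × ℝ) :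
    dist (hexCoord l a X) (hexCoord l a Y) ^ 2 = hexDist (l ^ 2) (a ^ 2) X Y := by
  have h3 : √3 * √3 = 3 := Real.mul_self_sqrt (by norm_num)
  rw [EuclideanSpace.dist_eq, Real.sq_sqrt (Finset.sum_nonneg fun _ _ => sq_nonneg _)]
  simp only [hexCoord, Fin.sum_univ_three, Real.dist_eq, sq_abs, hexDist]
  simp
  linear_combination (l ^ 2 * (X.2.1 - Y.2.1) ^ 2 / 4) * h3

theorem hexCoord_surjective (hl : l ≠ 0) (ha : a ≠ 0) : Function.Surjective (hexCoord l a) := by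
  intro p
  have h3 : √3 ≠ 0 := by positivity
  refine ⟨(p 0 / l - p 1 / (√3 * l), 2 * p 1 / (√3 * l), p 2 / a), ?_⟩
  ext i
  fin_cases i
  · simp [hexCoord]; field_simp; ring
  · simp [hexCoord]; field_simp
  · simp [hexCoord]; field_simp

theorem hexCoord_injective (hl : l ≠ 0) (ha : a ≠ 0) : Function.Injective (hexCoord l a) := by
  rintro ⟨u, v, w⟩ ⟨u', v', w'⟩ h
  have h3 : √3 ≠ 0 := by positivity
  have e0 := congrArg (fun p : E3 => p 0) h
  have e1 := congrArg (fun p : E3 => p 1) h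
  have e2 := congrArg (fun p : E3 => p 2) h
  simp [hexCoord, hl, ha] at e0 e1 e2
  subst e1 e2
  simp at e0
  rw [e0]

theorem addRight_hexCoord_one (l a u v w : ℝ) :
    IsometryEquiv.addRight !₂[l, 0, 0] (hexCoord l a (u, v, w)) = hexCoord l a (u + 1, v, w) := by
  ext i
  fin_cases i <;> simp [hexCoord]
  ring

theorem addRight_hexCoord_two (l a u v w : ℝ) :
    IsometryEquiv.addRight !₂[l / 2, √3 / 2 * l, 0] (hexCoord l a (u, v, w)) =
      hexCoord l a (u, v + 1, w) := by
  ext i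
  fin_cases i <;> simp [hexCoord] <;> ring

theorem screwSix_apply (t : ℝ) (p : E3) :
    screwSix t p = !₂[p 0 / 2 - √3 / 2 * p 1, √3 / 2 * p 0 + p 1 / 2, p 2 + t] := rfl

theorem halfTurn_apply (p : E3) : halfTurn p = !₂[p 0, -p 1, -p 2] := rfl

theorem screwSix_hexCoord (l a u v w : ℝ) :
    screwSix a (hexCoord l a (u, v, w)) = hexCoord l a (-v, u + v, w + 1) := by
  have h3 : √3 * √3 = 3 := Real.mul_self_sqrt (by norm_num)
  ext i
  fin_cases i
  · simp [hexCoord, screwSix_apply]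
    linear_combination (-(l * v) / 4) * h3
  · simp [hexCoord, screwSix_apply]; ring
  · simp [hexCoord, screwSix_apply]; ring

theorem halfTurn_hexCoord (l a u v w : ℝ) :
    halfTurn (hexCoord l a (u, v, w)) = hexCoord l a (u + v, -v, -w) := by
  ext i
  fin_cases i <;> simp [hexCoord, halfTurn_apply]
  left
  ring

theorem hexOrbit_add_one_left (X : ℝ × ℝ × ℝ) (u v w : ℝ) :
    (u, v, w) ∈ hexOrbit X ↔ (u + 1, v, w) ∈ hexOrbit X := by
  constructor
  · rintro ⟨k, ⟨m, n, h⟩ | ⟨m, n, h⟩⟩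
    · refine ⟨k, Or.inl ⟨m + 1, n, ?_⟩⟩
      simp only [Prod.mk.injEq] at h ⊢
      push_cast
      exact ⟨by linarith [h.1], h.2.1, h.2.2⟩
    · refine ⟨k, Or.inr ⟨m + 1, n, ?_⟩⟩
      simp only [Prod.mk.injEq] at h ⊢
      push_cast
      exact ⟨by linarith [h.1], h.2.1, h.2.2⟩
  · rintro ⟨k, ⟨m, n, h⟩ | ⟨m, n, h⟩⟩
    · refine ⟨k, Or.inl ⟨m - 1, n, ?_⟩⟩
      simp only [Prod.mk.injEq] at h ⊢
      push_cast
      exact ⟨by linarith [h.1], h.2.1, h.2.2⟩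
    · refine ⟨k, Or.inr ⟨m - 1, n, ?_⟩⟩
      simp only [Prod.mk.injEq] at h ⊢
      push_cast
      exact ⟨by linarith [h.1], h.2.1, h.2.2⟩

theorem hexOrbit_add_one_right (X : ℝ × ℝ × ℝ) (u v w : ℝ) :
    (u, v, w) ∈ hexOrbit X ↔ (u, v + 1, w) ∈ hexOrbit X := by
  constructor
  · rintro ⟨k, ⟨m, n, h⟩ | ⟨m, n, h⟩⟩
    · refine ⟨k, Or.inl ⟨m, n + 1, ?_⟩⟩
      simp only [Prod.mk.injEq] at h ⊢
      push_cast
      exact ⟨h.1, by linarith [h.2.1], h.2.2⟩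
    · refine ⟨k, Or.inr ⟨m, n + 1, ?_⟩⟩
      simp only [Prod.mk.injEq] at h ⊢
      push_cast
      exact ⟨h.1, by linarith [h.2.1], h.2.2⟩
  · rintro ⟨k, ⟨m, n, h⟩ | ⟨m, n, h⟩⟩
    · refine ⟨k, Or.inl ⟨m, n - 1, ?_⟩⟩
      simp only [Prod.mk.injEq] at h ⊢
      push_cast
      exact ⟨h.1, by linarith [h.2.1], h.2.2⟩
    · refine ⟨k, Or.inr ⟨m, n - 1, ?_⟩⟩
      simp only [Prod.mk.injEq] at h ⊢
      push_cast
      exact ⟨h.1, by linarith [h.2.1], h.2.2⟩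

theorem hexOrbit_screw (X : ℝ × ℝ × ℝ) (u v w : ℝ) :
    (u, v, w) ∈ hexOrbit X ↔ (-v, u + v, w + 1) ∈ hexOrbit X := by
  constructor
  · rintro ⟨k, ⟨m, n, h⟩ | ⟨m, n, h⟩⟩ <;> simp only [Prod.mk.injEq] at h <;>
      obtain ⟨h1, h2, h3⟩ := h
    · refine ⟨k + 1, Or.inl ⟨-n, m + n, ?_⟩⟩
      rw [rotA_add_one, rotB_add_one]
      simp only [Prod.mk.injEq]
      push_cast
      exact ⟨by linarith, by linarith, by linarith⟩
    · refine ⟨k + 1, Or.inr ⟨-n, m + n, ?_⟩⟩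
      rw [rotA_add_one, rotB_add_one]
      simp only [Prod.mk.injEq]
      push_cast
      exact ⟨by linarith, by linarith, by linarith⟩
  · rintro ⟨k, ⟨m, n, h⟩ | ⟨m, n, h⟩⟩ <;> simp only [Prod.mk.injEq] at h <;>
      obtain ⟨h1, h2, h3⟩ := h
    · refine ⟨k - 1, Or.inl ⟨m + n, -m, ?_⟩⟩
      rw [rotA_sub_one, rotB_sub_one]
      simp only [Prod.mk.injEq]
      push_cast
      exact ⟨by linarith, by linarith, by linarith⟩
    · refine ⟨k - 1, Or.inr ⟨m + n, -m, ?_⟩⟩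
      rw [rotA_sub_one, rotB_sub_one]
      simp only [Prod.mk.injEq]
      push_cast
      exact ⟨by linarith, by linarith, by linarith⟩

theorem rotA_neg (k : ℤ) : rotA (-k) = rotA k + rotB k := by
  unfold rotA rotB
  push_cast
  generalize (k : ZMod 6) = x
  revert x
  decide

theorem rotB_neg (k : ℤ) : rotB (-k) = -rotB k := by
  unfold rotB
  push_cast
  generalize (k : ZMod 6) = x
  revert x
  decide

theorem hexOrbit_turn_imp (X : ℝ × ℝ × ℝ) {u v w : ℝ} (h : (u, v, w) ∈ hexOrbit X) :
    (u + v, -v, -w) ∈ hexOrbit X := by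
  obtain ⟨k, ⟨m, n, h⟩ | ⟨m, n, h⟩⟩ := h <;> simp only [Prod.mk.injEq] at h <;>
    obtain ⟨h1, h2, h3⟩ := h
  · refine ⟨-k, Or.inr ⟨m + n, -n, ?_⟩⟩
    rw [rotA_neg, rotB_neg]
    simp only [Prod.mk.injEq]
    push_cast
    exact ⟨by linarith, by linarith, by linarith⟩
  · refine ⟨-k, Or.inl ⟨m + n, -n, ?_⟩⟩
    rw [rotA_neg, rotB_neg]
    simp only [Prod.mk.injEq]
    push_cast
    exact ⟨by linarith, by linarith, by linarith⟩

theorem hexOrbit_turn (X : ℝ × ℝ × ℝ) (u v w : ℝ) :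
    (u, v, w) ∈ hexOrbit X ↔ (u + v, -v, -w) ∈ hexOrbit X := by
  refine ⟨hexOrbit_turn_imp X, fun h => ?_⟩
  convert hexOrbit_turn_imp X h using 2
  · ring
  · simp

theorem mem_hexOrbit_self (X : ℝ × ℝ × ℝ) : X ∈ hexOrbit X :=
  ⟨0, Or.inl ⟨0, 0, by simp [rotA_zero, rotB_zero]⟩⟩

end Coordinates

/-! ### The orbit in hexagonal coordinates, local finiteness, and conjugation -/

section Orbit

variable {l a : ℝ}

/-- The equivalence, rather than one implication, is what lets the closure induction pass to
inverses. -/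
theorem hexCoord_mem_image_hexOrbit_iff (hl : l ≠ 0) (ha : a ≠ 0) (X : ℝ × ℝ × ℝ)
    {g : E3 ≃ᵢ E3} (hg : g ∈ groupP6122 l (6 * a)) :
    ∀ Q, Q ∈ hexCoord l a '' hexOrbit X ↔ g Q ∈ hexCoord l a '' hexOrbit X := by
  have hinj := hexCoord_injective hl ha
  induction hg using Subgroup.closure_induction with
  | mem g hg =>
    intro Q
    obtain ⟨⟨u, v, w⟩, rfl⟩ := hexCoord_surjective hl ha Q
    simp only [Set.mem_insert_iff, Set.mem_singleton_iff] at hg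
    rcases hg with rfl | rfl | rfl | rfl
    · rw [addRight_hexCoord_one, hinj.mem_set_image, hinj.mem_set_image, hexOrbit_add_one_left]
    · rw [addRight_hexCoord_two, hinj.mem_set_image, hinj.mem_set_image, hexOrbit_add_one_right]
    · rw [mul_div_cancel_left₀ a (by norm_num : (6 : ℝ) ≠ 0), screwSix_hexCoord,
        hinj.mem_set_image, hinj.mem_set_image, hexOrbit_screw]
    · rw [halfTurn_hexCoord, hinj.mem_set_image, hinj.mem_set_image, hexOrbit_turn]
  | one => intro Q; rfl
  | mul g h _ _ ihg ihh => intro Q; rw [ihh, ihg]; rfl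
  | inv g _ ih => intro Q; rw [ih (g⁻¹ Q)]; simp

theorem pointOrbit_subset_image_hexOrbit (hl : l ≠ 0) (ha : a ≠ 0) (X : ℝ × ℝ × ℝ) :
    pointOrbit (groupP6122 l (6 * a)) (hexCoord l a X) ⊆ hexCoord l a '' hexOrbit X := by
  rintro _ ⟨g, hg, rfl⟩
  exact (hexCoord_mem_image_hexOrbit_iff hl ha X hg _).1 ⟨X, mem_hexOrbit_self X, rfl⟩

theorem apply_mem_pointOrbit {G : Subgroup (E3 ≃ᵢ E3)} {P Q : E3} {g : E3 ≃ᵢ E3} (hg : g ∈ G)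
    (hQ : Q ∈ pointOrbit G P) : g Q ∈ pointOrbit G P := by
  obtain ⟨h, hh, rfl⟩ := hQ
  exact ⟨g * h, G.mul_mem hg hh, rfl⟩

theorem self_mem_pointOrbit (G : Subgroup (E3 ≃ᵢ E3)) (P : E3) : P ∈ pointOrbit G P :=
  ⟨1, G.one_mem, rfl⟩

theorem forall_int_mem_of_add_one {p : ℝ → Prop} (h1 : ∀ x, p x → p (x + 1))
    (h2 : ∀ x, p x → p (x - 1)) {x : ℝ} (hx : p x) (m : ℤ) : p (x + m) := by
  induction m using Int.induction_on with
  | zero => simpa using hx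
  | succ i ih => have := h1 _ ih; push_cast; rwa [← add_assoc]
  | pred i ih => have := h2 _ ih; push_cast at this ⊢; rwa [← add_sub_assoc]

theorem isHexInvariant_pointOrbit (l a : ℝ) (P : E3) :
    IsHexInvariant {X | hexCoord l a X ∈ pointOrbit (groupP6122 l (6 * a)) P} := by
  have hmem : ∀ g ∈ ({IsometryEquiv.addRight !₂[l, 0, 0],
      IsometryEquiv.addRight !₂[l / 2, √3 / 2 * l, 0], screwSix (6 * a / 6),
      halfTurn} : Set (E3 ≃ᵢ E3)), g ∈ groupP6122 l (6 * a) :=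
    fun g hg => Subgroup.subset_closure hg
  have hmem' := fun g hg => (groupP6122 l (6 * a)).inv_mem (hmem g hg)
  rw [mul_div_cancel_left₀ a (by norm_num : (6 : ℝ) ≠ 0)] at hmem hmem'
  refine ⟨?_, ?_, ?_, ?_⟩
  · intro u v w h m n
    have k1 : hexCoord l a (u + m, v, w) ∈ pointOrbit (groupP6122 l (6 * a)) P := by
      refine forall_int_mem_of_add_one
        (p := fun x => hexCoord l a (x, v, w) ∈ pointOrbit (groupP6122 l (6 * a)) P) ?_ ?_ h m
      · intro x hx
        rw [← addRight_hexCoord_one]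
        exact apply_mem_pointOrbit (hmem _ (by simp)) hx
      · intro x hx
        have := apply_mem_pointOrbit (hmem' (IsometryEquiv.addRight !₂[l, 0, 0]) (by simp)) hx
        rwa [← sub_add_cancel x 1, ← addRight_hexCoord_one, IsometryEquiv.inv_apply_self] at this
    refine forall_int_mem_of_add_one
      (p := fun x => hexCoord l a (u + m, x, w) ∈ pointOrbit (groupP6122 l (6 * a)) P) ?_ ?_ k1 n
    · intro x hx
      rw [← addRight_hexCoord_two]
      exact apply_mem_pointOrbit (hmem _ (by simp)) hx
    · intro x hx
      have := apply_mem_pointOrbit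
        (hmem' (IsometryEquiv.addRight !₂[l / 2, √3 / 2 * l, 0]) (by simp)) hx
      rwa [← sub_add_cancel x 1, ← addRight_hexCoord_two, IsometryEquiv.inv_apply_self] at this
  · intro u v w h
    have := apply_mem_pointOrbit (hmem (screwSix a) (by simp)) h
    rwa [screwSix_hexCoord] at this
  · intro u v w h
    have := apply_mem_pointOrbit (hmem' (screwSix a) (by simp)) h
    have e : hexCoord l a (u, v, w) = screwSix a (hexCoord l a (u + v, -u, w - 1)) := by
      rw [screwSix_hexCoord]
      congr 2
      · ring
      · congr 1 <;> ring
    rwa [e, IsometryEquiv.inv_apply_self] at this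
  · intro u v w h
    have := apply_mem_pointOrbit (hmem halfTurn (by simp)) h
    rwa [halfTurn_hexCoord] at this

theorem finite_int_abs_add_le (x M : ℝ) : {m : ℤ | |x + m| ≤ M}.Finite := by
  refine (Set.finite_Icc ⌊-M - x⌋ ⌈M - x⌉).subset fun m hm => ?_
  replace hm : |x + m| ≤ M := hm
  obtain ⟨hm1, hm2⟩ := abs_le.1 hm
  constructor
  · have := Int.floor_le (-M - x)
    exact_mod_cast (by linarith : ((⌊-M - x⌋ : ℤ) : ℝ) ≤ m)
  · have := Int.le_ceil (M - x)
    exact_mod_cast (by linarith : (m : ℝ) ≤ ((⌈M - x⌉ : ℤ) : ℝ))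

theorem finite_hexOrbit_inter (X : ℝ × ℝ × ℝ) (M : ℝ) :
    {Y ∈ hexOrbit X | |Y.1| ≤ M ∧ |Y.2.1| ≤ M ∧ |Y.2.2| ≤ M}.Finite := by
  have hlat : ∀ p q h : ℝ, {Y : ℝ × ℝ × ℝ | (∃ m n : ℤ, Y = (p + m, q + n, h)) ∧
      |Y.1| ≤ M ∧ |Y.2.1| ≤ M ∧ |Y.2.2| ≤ M}.Finite := by
    intro p q h
    refine (((finite_int_abs_add_le p M).prod (finite_int_abs_add_le q M)).image
      fun x => ((p + x.1, q + x.2, h) : ℝ × ℝ × ℝ)).subset ?_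
    rintro _ ⟨⟨m, n, rfl⟩, h1, h2, -⟩
    exact ⟨(m, n), ⟨h1, h2⟩, rfl⟩
  have h1 := (finite_int_abs_add_le X.2.2 M).biUnion fun k _ =>
    hlat (rotA k * X.1 - rotB k * X.2.1) (rotB k * X.1 + (rotA k + rotB k) * X.2.1) (X.2.2 + k)
  have h2 := (finite_int_abs_add_le (-X.2.2) M).biUnion fun k _ =>
    hlat (rotA k * (X.1 + X.2.1) + rotB k * X.2.1)
      (rotB k * (X.1 + X.2.1) - (rotA k + rotB k) * X.2.1) (-X.2.2 + k)
  refine (h1.union h2).subset ?_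
  rintro Y ⟨⟨k, hk | hk⟩, hY⟩
  · refine Or.inl (Set.mem_biUnion (x := k) ?_ ⟨hk, hY⟩)
    obtain ⟨m, n, rfl⟩ := hk
    exact hY.2.2
  · refine Or.inr (Set.mem_biUnion (x := k) ?_ ⟨hk, hY⟩)
    obtain ⟨m, n, rfl⟩ := hk
    exact hY.2.2

theorem abs_le_of_hexDist_le {A B r : ℝ} (hA : 0 < A) (hB : 0 < B) {X Y : ℝ × ℝ × ℝ}
    (h : hexDist A B X Y ≤ r) : (X.1 - Y.1) ^ 2 ≤ 2 * (r / A) ∧ (X.2.1 - Y.2.1) ^ 2 ≤ 2 * (r / A) ∧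
      (X.2.2 - Y.2.2) ^ 2 ≤ r / B := by
  unfold hexDist at h
  set x := X.1 - Y.1
  set y := X.2.1 - Y.2.1
  set z := X.2.2 - Y.2.2
  have h1 : 0 ≤ A * (x ^ 2 + x * y + y ^ 2) :=
    mul_nonneg hA.le (by nlinarith [sq_nonneg (x + y), sq_nonneg x, sq_nonneg y])
  have h2 : 0 ≤ B * z ^ 2 := by positivity
  have h3 : x ^ 2 + x * y + y ^ 2 ≤ r / A := by
    rw [le_div_iff₀ hA]; linarith
  refine ⟨?_, ?_, ?_⟩
  · nlinarith [sq_nonneg (x + y), sq_nonneg y]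
  · nlinarith [sq_nonneg (x + y), sq_nonneg x]
  · rw [le_div_iff₀ hB]; linarith

/-- The quadratic form is positive definite, so a ball bounds all three coordinates, leaving
finitely many layers and finitely many lattice vectors in each. -/
theorem finite_pointOrbit_inter (hl : 0 < l) (ha : 0 < a) (P x : E3) (r : ℝ) :
    {Q ∈ pointOrbit (groupP6122 l (6 * a)) P | dist x Q ≤ r}.Finite := by
  obtain ⟨X, rfl⟩ := hexCoord_surjective hl.ne' ha.ne' P
  obtain ⟨Z, rfl⟩ := hexCoord_surjective hl.ne' ha.ne' x
  set M := |Z.1| + |Z.2.1| + |Z.2.2| + √(2 * (r ^ 2 / l ^ 2)) + √(r ^ 2 / a ^ 2) with hM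
  refine ((finite_hexOrbit_inter X M).image (hexCoord l a)).subset ?_
  rintro Q ⟨hQ, hr⟩
  obtain ⟨Y, hY, rfl⟩ := pointOrbit_subset_image_hexOrbit hl.ne' ha.ne' X hQ
  have h1 : hexDist (l ^ 2) (a ^ 2) Z Y ≤ r ^ 2 := by
    rw [← dist_hexCoord]
    exact pow_le_pow_left₀ dist_nonneg hr 2
  obtain ⟨k1, k2, k3⟩ := abs_le_of_hexDist_le (by positivity) (by positivity) h1
  have key : ∀ s t q : ℝ, (s - t) ^ 2 ≤ q → |t| ≤ |s| + √q := by
    intro s t q h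
    have h1 := Real.abs_le_sqrt h
    have h2 := abs_sub_abs_le_abs_sub t s
    rw [abs_sub_comm] at h2
    linarith
  have p1 := abs_nonneg Z.1
  have p2 := abs_nonneg Z.2.1
  have p3 := abs_nonneg Z.2.2
  have p4 := Real.sqrt_nonneg (2 * (r ^ 2 / l ^ 2))
  have p5 := Real.sqrt_nonneg (r ^ 2 / a ^ 2)
  refine ⟨Y, ⟨hY, ?_, ?_, ?_⟩, rfl⟩
  · linarith [key _ _ _ k1]
  · linarith [key _ _ _ k2]
  · linarith [key _ _ _ k3]

theorem encard_voronoiNeighbors_standard_le (hl : 0 < l) (ha : 0 < a) (P : E3) :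
    (voronoiNeighbors (pointOrbit (groupP6122 l (6 * a)) P) P).encard ≤ 78 := by
  have hinj := hexCoord_injective hl.ne' ha.ne'
  obtain ⟨X, rfl⟩ := hexCoord_surjective hl.ne' ha.ne' P
  set O := {Y | hexCoord l a Y ∈ pointOrbit (groupP6122 l (6 * a)) (hexCoord l a X)} with hO
  have hbound := encard_neighborSet_le (A := l ^ 2) (B := a ^ 2) (by positivity) (by positivity)
    (isHexInvariant_pointOrbit l a (hexCoord l a X)) (X := X) (self_mem_pointOrbit _ _)
    (fun Y hY => (hinj.mem_set_image).1 (pointOrbit_subset_image_hexOrbit hl.ne' ha.ne' X hY))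
  refine le_trans ?_ hbound
  have hsub : voronoiNeighbors (pointOrbit (groupP6122 l (6 * a)) (hexCoord l a X))
      (hexCoord l a X) ⊆ hexCoord l a '' neighborSet (l ^ 2) (a ^ 2) O X := by
    rintro Q ⟨hQ, hne, x, h1, h2⟩
    obtain ⟨Y, rfl⟩ := hexCoord_surjective hl.ne' ha.ne' Q
    obtain ⟨Z, rfl⟩ := hexCoord_surjective hl.ne' ha.ne' x
    refine ⟨Y, ⟨hQ, fun h => hne (by rw [h]), Z, ?_, ?_⟩, rfl⟩
    · rw [← dist_hexCoord, ← dist_hexCoord, h1]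
    · intro W hW hWX hWY
      rw [← dist_hexCoord, ← dist_hexCoord]
      exact pow_lt_pow_left₀ (h2 _ hW (hinj.ne hWX) (hinj.ne hWY)) dist_nonneg two_ne_zero
  exact (Set.encard_le_encard hsub).trans (Set.encard_image_le _ _)

theorem pointOrbit_conj (G : Subgroup (E3 ≃ᵢ E3)) (φ : E3 ≃ᵢ E3) (P : E3) :
    pointOrbit (G.map (MulAut.conj φ).toMonoidHom) P = φ '' pointOrbit G (φ.symm P) := by
  ext Q
  constructor
  · rintro ⟨_, ⟨g, hg, rfl⟩, rfl⟩
    exact ⟨g (φ.symm P), ⟨g, hg, rfl⟩, rfl⟩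
  · rintro ⟨_, ⟨g, hg, rfl⟩, rfl⟩
    exact ⟨_, ⟨g, hg, rfl⟩, rfl⟩

theorem voronoiNeighbors_image_subset (S : Set E3) (φ : E3 ≃ᵢ E3) (P : E3) :
    voronoiNeighbors (φ '' S) P ⊆ φ '' voronoiNeighbors S (φ.symm P) := by
  obtain ⟨P, rfl⟩ := φ.surjective P
  rw [φ.symm_apply_apply]
  rintro _ ⟨⟨Q, hQ, rfl⟩, hne, x, h1, h2⟩
  obtain ⟨x, rfl⟩ := φ.surjective x
  refine ⟨Q, ⟨hQ, fun h => hne (by rw [h]), x, ?_, fun R hR hRP hRQ => ?_⟩, rfl⟩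
  · rwa [φ.dist_eq, φ.dist_eq] at h1
  have := h2 (φ R) ⟨R, hR, rfl⟩ (φ.injective.ne hRP) (φ.injective.ne hRQ)
  rwa [φ.dist_eq, φ.dist_eq] at this

end Orbit

theorem mainTheorem3 (G : Subgroup (E3 ≃ᵢ E3)) (hG : IsOfTypeP6122 G) (P : E3) :
    (facets (dirichletStereohedron G P)).encard ≤ 78 := by
  obtain ⟨l, c, hl, hc, φ, rfl⟩ := hG
  obtain ⟨a, rfl⟩ : ∃ a, c = 6 * a := ⟨c / 6, by ring⟩
  have ha : 0 < a := by linarith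
  unfold dirichletStereohedron
  rw [pointOrbit_conj]
  refine (encard_facets_le ?_ P).trans
    ((Set.encard_le_encard (voronoiNeighbors_image_subset _ φ P)).trans
      ((Set.encard_image_le _ _).trans (encard_voronoiNeighbors_standard_le hl ha _)))
  intro x r
  refine ((finite_pointOrbit_inter hl ha (φ.symm P) (φ.symm x) r).image φ).subset ?_
  rintro _ ⟨⟨Q, hQ, rfl⟩, hr⟩
  refine ⟨Q, ⟨hQ, ?_⟩, rfl⟩
  rwa [← φ.dist_eq, φ.apply_symm_apply]
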